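/- Let $\gamma\in(0,1)$ and consider a Markov decision process with state space $\mathcal S$ (a measurable space), action space $\mathcal A$ (a separable metric space), transition probability $T(\cdot\mid s,a)$ and bounded measurable deterministic reward $r(s,a)$. Let $\rho_0$ be an initial state distribution, $\pi^1,\dots,\pi^N$ ($N\ge1$) given policies (Markov kernels from $\mathcal S$ to $\mathcal A$), $w_1,\dots,w_N>0$ weights, $\hat Q:\mathcal S\times\mathcal A\to\mathbb R$ a given measurable function, and $0\le i\le L$ integers. The replay buffer consists of $N$ independent trajectories $\{(s_j^e,a_j^e)\}_{j=0}^{L-1}$, $e=1,\dots,N$, the $e$-th one being generated by $s_0^e\sim\rho_0$, $a_j^e\sim\pi^e(\cdot\mid s_j^e)$, $s_{j+1}^e\sim T(\cdot\mid s_j^e,a_j^e)$. Write $Q^{\pi}(s,a)=\mathbb E\big[\sum_{j\ge0}\gamma^jr(s_j,a_j)\mid s_0=s,a_0=a\big]$ (actions from $\pi$ after step $0$) and $(\mathcal B^{\pi}Q)(s,a)=r(s,a)+\gamma\,\mathbb E_{s'\sim T(\cdot\mid s,a),\,a'\sim\pi(\cdot\mid s')}Q(s',a')$. Let $\rho_j^e$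 be the distribution of $s_j$ under $(\rho_0,\pi^e,T)$, and let $$\rho^{\pi^e}_{\rho_i^e}=(1-\gamma)\sum_{j\ge i}\gamma^{j-i}\rho_j^e,\qquad \overline\rho_{i,w}=\frac{\sum_ew_e\rho_i^e}{\sum_ew_e},\qquad \pi^D_{i,w}(\cdot\mid s)=\frac{\sum_ew_e\,\rho^{\pi^e}_{\rho_i^e}(s)\,\pi^e(\cdot\mid s)}{\sum_ew_e\,\rho^{\pi^e}_{\rho_i^e}(s)},$$ where in the last formula $\rho^{\pi^e}_{\rho_i^e}(s)$ are densities with respect to a common dominating measure. For a function $f$ of $(s,a)$ put $$\tilde E_{i,w}^{L}f=\frac{1}{\sum_ew_e}\sum_{e=1}^N\sum_{j=i}^{L-1}(1-\gamma)\gamma^{j-i}w_ef(s_j^e,a_j^e),$$ $$\epsilon_{\hat Q,w}^{i,L}=\tilde E_{i,w}^L\big|\hat Q-\mathcal B^{\pi^N}\hat Q\big|,\qquad W_{1,w}^{i,L}=\tilde E_{i,w}^L\,W_1\big(\pi^N(\cdot\mid s),\pi^D_{i,w}(\cdot\mid s)\big),$$ with $W_1$ the 1-Wasserstein distance. Assume: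 (1) for each $s$, $\hat Q(s,a)$ and $Q^{\pi^N}(s,a)$ are $L_{\mathcal A}$-Lipschitz in $a$; (2) $\hat Q$ and $Q^{\pi^N}$ take values in $[0,r^{\max}/(1-\gamma)]$; (3) $\mathcal A$ is bounded, with diameter $\mathrm{diam}_{\mathcal A}<\infty$. Let $0<\delta<1$. Then, with probability greater than $1-\delta$, $$\mathbb E_{(s,a)\sim\overline\rho_{i,w}(s)\pi^D_{i,w}(a\mid s)}\big|\hat Q(s,a)-Q^{\pi^N}(s,a)\big|\le\frac{r^{\max}}{1-\gamma}\sqrt{\frac{\sum_ew_e^2}{2(\sum_ew_e)^2}\log\frac2\delta}$$ $$\quad+\Big(\frac{r^{\max}}{(1-\gamma)^2}+\frac{2L_{\mathcal A}\mathrm{diam}_{\mathcal A}}{1-\gamma}\Big)\Big(\sqrt{\frac{2\sum_ew_e^2}{(\sum_ew_e)^2}\log\frac2\delta}+\gamma^{L-i}\Big)+\frac1{1-\gamma}\Big(\epsilon_{\hat Q,w}^{i,L}+2L_{\mathcal A}W_{1,w}^{i,L}\Big).$$ Moreover, there is an absolute constant $C>0$ such that, if in addition $0<\epsilon<1$, $i\le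 L-\frac{\log\epsilon}{\log\gamma}$, $L_{\mathcal A}=c/(1-\gamma)$ and $\epsilon_{\hat Q,w}^{i,L}=\xi_{\hat Q,w}^{i,L}/(1-\gamma)$, then, with probability greater than $1-\delta$, $$\mathbb E_{(s,a)\sim\overline\rho_{i,w}(s)\pi^D_{i,w}(a\mid s)}\big|\hat Q(s,a)-Q^{\pi^N}(s,a)\big|\le C\sqrt{\log\tfrac2\delta}\;\frac{1}{(1-\gamma)^2}\Big((r^{\max}+c\,\mathrm{diam}_{\mathcal A})\Big(\frac{\sqrt{\sum_ew_e^2}}{\sum_ew_e}+\epsilon\Big)+\xi_{\hat Q,w}^{i,L}+c\,W_{1,w}^{i,L}\Big),$$ that is, the left side is $\tilde O$ of the expression without the factor $\sqrt{\log(2/\delta)}$. -/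

import Mathlib

open MeasureTheory ProbabilityTheory
open scoped ENNReal NNReal

namespace OffPolicy

/-- A discounted Markov decision process with state space `S` and action space `A`: a transition
probability `T(· | s, a)`, a deterministic reward `r(s, a)` and a discount factor `γ ∈ (0, 1)`. -/
structure MDP (S A : Type*) [MeasurableSpace S] [MeasurableSpace A] where
  transition : Kernel (S × A) S
  markov : IsMarkovKernel transition
  reward : S → A → ℝ
  measurable_reward : Measurable (Function.uncurry reward)
  discount : ℝ
  discount_pos : 0 < discount
  discount_lt_one : discount < 1

attribute [instance] MDP.markov

section Chain

variable {S A : Type*} [MeasurableSpace S] [MeasurableSpace A]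

/-- One step of the state-action chain under the policy `π`: from `(s, a)`, draw
`s' ∼ T(· | s, a)` and then `a' ∼ π(· | s')`. -/
noncomputable def stepKernel (M : MDP S A) (π : Kernel S A) : Kernel (S × A) (S × A) :=
  M.transition ⊗ₖ Kernel.prodMkLeft (S × A) π

instance (M : MDP S A) (π : Kernel S A) [IsMarkovKernel π] : IsMarkovKernel (stepKernel M π) := by
  unfold stepKernel; infer_instance

/-- The same step, as a kernel from the history up to time `n` to the state-action pair at time
`n + 1`. -/
noncomputable def historyKernel (M : MDP S A) (π : Kernel S A) (n : ℕ) :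
    Kernel ((_ : Finset.Iic n) → S × A) (S × A) :=
  (stepKernel M π).comap (fun h => h ⟨n, Finset.mem_Iic.2 le_rfl⟩) (measurable_pi_apply _)

instance (M : MDP S A) (π : Kernel S A) [IsMarkovKernel π] (n : ℕ) :
    IsMarkovKernel (historyKernel M π n) := by
  unfold historyKernel; infer_instance

/-- The law of the infinite state-action trajectory `(s₀, a₀), (s₁, a₁), …` when `(s₀, a₀) ∼ μ`,
`s_{j+1} ∼ T(· | s_j, a_j)` and `a_{j+1} ∼ π(· | s_{j+1})`. -/
noncomputable def trajLaw (M : MDP S A) (π : Kernel S A) [IsMarkovKernel π]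
    (μ : Measure (S × A)) : Measure (ℕ → S × A) :=
  Kernel.trajMeasure (X := fun _ => S × A) μ (historyKernel M π)

/-- The law of the trajectory generated by `(ρ₀, π, T)`. -/
noncomputable def policyLaw (M : MDP S A) (π : Kernel S A) [IsMarkovKernel π]
    (ρ₀ : Measure S) : Measure (ℕ → S × A) :=
  trajLaw M π (ρ₀ ⊗ₘ π)

/-- The law of the length-`L` trajectory `(s_j, a_j)_{0 ≤ j ≤ L - 1}` generated by `(ρ₀, π, T)`. -/
noncomputable def sampleLaw (M : MDP S A) (π : Kernel S A) [IsMarkovKernel π]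
    (ρ₀ : Measure S) (L : ℕ) : Measure (Fin L → S × A) :=
  (policyLaw M π ρ₀).map (fun x j => x j)

/-- The Q function of the policy `π`: `Q^π(s, a) = E[∑_j γ^j r(s_j, a_j) | s₀ = s, a₀ = a]`. -/
noncomputable def qFun (M : MDP S A) (π : Kernel S A) [IsMarkovKernel π] (s : S) (a : A) : ℝ :=
  ∫ x, ∑' j : ℕ, M.discount ^ j * M.reward (x j).1 (x j).2 ∂(trajLaw M π (Measure.dirac (s, a)))

/-- The Bellman operator: `(B^π Q)(s, a) = r(s, a) + γ E_{s' ∼ T(· | s, a), a' ∼ π(· | s')} Q(s', a')`. -/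
noncomputable def bellman (M : MDP S A) (π : Kernel S A) (Q : S → A → ℝ) (s : S) (a : A) : ℝ :=
  M.reward s a + M.discount * ∫ s', ∫ a', Q s' a' ∂(π s') ∂(M.transition (s, a))

/-- The state distribution at trajectory step `j` under `(ρ₀, π, T)`. -/
noncomputable def stateDist (M : MDP S A) (π : Kernel S A) [IsMarkovKernel π]
    (ρ₀ : Measure S) (j : ℕ) : Measure S :=
  (policyLaw M π ρ₀).map (fun x => (x j).1)

/-- The normalized state occupancy measure started at step `i`:
`(1 - γ) ∑_{j ≥ i} γ^{j - i} ρ_j`, with `ρ_j` the state distribution at step `j`. -/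
noncomputable def occupancy (M : MDP S A) (π : Kernel S A) [IsMarkovKernel π]
    (ρ₀ : Measure S) (i : ℕ) : Measure S :=
  Measure.sum fun k : ℕ =>
    ENNReal.ofReal ((1 - M.discount) * M.discount ^ k) • stateDist M π ρ₀ (i + k)

end Chain

section Behavior

variable {S A : Type*} [MeasurableSpace S] [MeasurableSpace A] {n : ℕ}

/-- The weighted average `ρ̄_{i,w} = (∑_e w_e ρ_i^e) / ∑_e w_e` of the state distributions of the
episodes at step `i`. -/
noncomputable def avgStateDist (M : MDP S A) (ρ₀ : Measure S) (π : Fin (n + 1) → Kernel S A)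
    [∀ e, IsMarkovKernel (π e)] (w : Fin (n + 1) → ℝ) (i : ℕ) : Measure S :=
  ∑ e, ENNReal.ofReal (w e / ∑ e', w e') • stateDist M (π e) ρ₀ i

/-- `w_e` times the density at `s` of the occupancy measure of episode `e` started at step `i`.
Densities are taken with respect to the sum over all episodes of these occupancy measures, which
dominates each of them; every other dominating measure gives the same behavior policy, up to a null
set of states. -/
noncomputable def weightedDensity (M : MDP S A) (ρ₀ : Measure S) (π : Fin (n + 1) → Kernel S A)
    [∀ e, IsMarkovKernel (π e)] (w : Fin (n + 1) → ℝ) (i : ℕ) (e : Fin (n + 1)) (s : S) : ℝ≥0∞ :=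
  ENNReal.ofReal (w e) *
    (occupancy M (π e) ρ₀ i).rnDeriv (∑ e', occupancy M (π e') ρ₀ i) s

/-- The weighted behavior policy at step `i`: the mixture
`π^D_{i,w}(· | s) = (∑_e w_e ρ_e(s) π^e(· | s)) / (∑_e w_e ρ_e(s))`, where `ρ_e` is the density of the
occupancy measure of episode `e` started at step `i`. On the null set of states where the quotient
has no meaning it is set to the last policy, to make it a Markov kernel. -/
noncomputable def behaviorPolicy (M : MDP S A) (ρ₀ : Measure S) (π : Fin (n + 1) → Kernel S A)
    [∀ e, IsMarkovKernel (π e)] (w : Fin (n + 1) → ℝ) (i : ℕ) : Kernel S A where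
  toFun s :=
    open Classical in
    if (∑ e', weightedDensity M ρ₀ π w i e' s = 0 ∨ ∑ e', weightedDensity M ρ₀ π w i e' s = ∞) then
      π (Fin.last n) s
    else
      ∑ e, (weightedDensity M ρ₀ π w i e s / ∑ e', weightedDensity M ρ₀ π w i e' s) • π e s
  measurable' := by
    have hd : ∀ e, Measurable (weightedDensity M ρ₀ π w i e) := fun e =>
      (Measure.measurable_rnDeriv _ _).const_mul _
    have hs : Measurable fun s => ∑ e', weightedDensity M ρ₀ π w i e' s :=
      Finset.measurable_sum _ fun e _ => hd e
    refine Measurable.ite ?_ (π (Fin.last n)).measurable ?_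
    · exact (hs (measurableSet_singleton 0)).union (hs (measurableSet_singleton ∞))
    · refine Measure.measurable_of_measurable_coe _ fun t ht => ?_
      simp only [Measure.finsetSum_apply, Measure.smul_apply, smul_eq_mul]
      exact Finset.measurable_sum _ fun e _ =>
        ((hd e).div hs).mul ((π e).measurable_coe ht)

instance (M : MDP S A) (ρ₀ : Measure S) (π : Fin (n + 1) → Kernel S A)
    [∀ e, IsMarkovKernel (π e)] (w : Fin (n + 1) → ℝ) (i : ℕ) :
    IsMarkovKernel (behaviorPolicy M ρ₀ π w i) := by
  refine ⟨fun s => ⟨?_⟩⟩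
  change (ite _ _ _ : Measure A) Set.univ = 1
  split_ifs with h
  · exact measure_univ
  · push Not at h
    simp only [Measure.finsetSum_apply, Measure.smul_apply, smul_eq_mul, measure_univ, mul_one,
      div_eq_mul_inv, ← Finset.sum_mul]
    exact ENNReal.mul_inv_cancel h.1 h.2

/-- The weighted averaging-discounted operator over the replay buffer `x` of length-`L`
trajectories `x e = (s_j^e, a_j^e)_{j < L}`:
`Ẽ_{i,w}^L f = (∑_e w_e)⁻¹ ∑_e ∑_{j=i}^{L-1} (1 - γ) γ^{j-i} w_e f(s_j^e, a_j^e)`. -/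
noncomputable def replayMean {L : ℕ} (γ : ℝ) (w : Fin (n + 1) → ℝ) (i : ℕ)
    (x : Fin (n + 1) → Fin L → S × A) (f : S → A → ℝ) : ℝ :=
  (∑ e, w e)⁻¹ * ∑ e, ∑ j ∈ Finset.univ.filter (fun j : Fin L => i ≤ (j : ℕ)),
    (1 - γ) * γ ^ ((j : ℕ) - i) * w e * f (x e j).1 (x e j).2

end Behavior

/-- The 1-Wasserstein distance: the infimum over all couplings `Γ` of `μ` and `ν` of
`∫ d(a, b) dΓ(a, b)`. -/
noncomputable def wasserstein1 {A : Type*} [MeasurableSpace A] [PseudoEMetricSpace A]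
    (μ ν : Measure A) : ℝ :=
  (⨅ Γ ∈ {Γ : Measure (A × A) | Γ.map Prod.fst = μ ∧ Γ.map Prod.snd = ν},
    ∫⁻ p, edist p.1 p.2 ∂Γ).toReal

section Errors

variable {S A : Type*} [MeasurableSpace S] [MeasurableSpace A] {n : ℕ}

/-- The empirical Bellman error
`ε_{Q̂,w}^{i,L} = Ẽ_{i,w}^L |Q̂ - B^{π^N} Q̂|`, with `π^N` the last policy. -/
noncomputable def bellmanError {L : ℕ} (M : MDP S A) (π : Fin (n + 1) → Kernel S A)
    (w : Fin (n + 1) → ℝ) (i : ℕ) (x : Fin (n + 1) → Fin L → S × A) (Q : S → A → ℝ) : ℝ :=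
  replayMean M.discount w i x fun s a => |Q s a - bellman M (π (Fin.last n)) Q s a|

/-- The empirical policy mismatch error
`W_{1,w}^{i,L} = Ẽ_{i,w}^L W₁(π^N(· | s), π^D_{i,w}(· | s))`, with `π^N` the last policy. -/
noncomputable def policyMismatch {L : ℕ} [PseudoEMetricSpace A] (M : MDP S A) (ρ₀ : Measure S)
    (π : Fin (n + 1) → Kernel S A) [∀ e, IsMarkovKernel (π e)]
    (w : Fin (n + 1) → ℝ) (i : ℕ) (x : Fin (n + 1) → Fin L → S × A) : ℝ :=
  replayMean M.discount w i x fun s _ =>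
    wasserstein1 (π (Fin.last n) s) (behaviorPolicy M ρ₀ π w i s)

/-- The policy evaluation error
`E_{(s, a) ∼ ρ̄_{i,w}(s) π^D_{i,w}(a | s)} |Q̂(s, a) - Q^{π^N}(s, a)|`, with `π^N` the last policy. -/
noncomputable def evalError (M : MDP S A) (ρ₀ : Measure S)
    (π : Fin (n + 1) → Kernel S A) [∀ e, IsMarkovKernel (π e)]
    (w : Fin (n + 1) → ℝ) (i : ℕ) (Q : S → A → ℝ) : ℝ :=
  ∫ p, |Q p.1 p.2 - qFun M (π (Fin.last n)) p.1 p.2|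
    ∂(avgStateDist M ρ₀ π w i ⊗ₘ behaviorPolicy M ρ₀ π w i)

end Errors

end OffPolicy

/-! Write G = |Q̂ - Q^{π^N}| and β for the behavior policy. Let a_k and b_k be the w-averages over
episodes of the mean of G at trajectory step i + k, the state having its law ρ_{i+k}^e and the
action being drawn from β for a_k and from the episode's own π^e for b_k. The quantity to bound is
a_0.

Two relations link the sequences. Since β is the mixture of the π^e weighted by discounted occupancy
densities, replacing π^e by β does not change the mixed occupancy law on state-action pairs, so ∑
γ^k (a_k - b_k) = 0 (`sum_occupancy_compProd`, `hasSum_behaviorPolicy_sub`). The Bellman equation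
for Q^{π^N} gives G ≤ |Q̂ - B Q̂| + γ E G, the expectation taking its next action from π^N. Changing
that action to β costs at most `policyGap`, so b_k ≤ c_k + γ (a_{k+1} + d_{k+1}), with c_k the mean
Bellman residual and d_k the mean policy gap.

Unrolling m = L - i steps leaves ∑_{k<m} γ^k (c_k + d_k), a remainder γ^m (a_m + d_m), and the
partial sum of γ^k (a_k - b_k). As the full series vanishes, that partial sum is minus a tail, and
the tail is small because G oscillates by at most 2 L_A diam in the action (`telescoping_bound`,
`evalError_le`). No equality of individual a_k and b_k is needed.

The remaining sum is, up to the factor 1 - γ, the expectation of a replay mean. One one-sided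
Hoeffding bound over the independent episodes replaces it by the sample value
(`exists_event_replayMean`). Concentration is applied to `policyGap`, which is visibly measurable.
Only afterwards is it compared pointwise with W₁ by the easy half of Kantorovich duality, so
measurability of s ↦ W₁ is never needed. The resulting bound does not involve the first square-root
term of the stated one. The second bound is arithmetic on the same event. -/

namespace OffPolicy

/-! ### The state-action chain, its marginals, and the Bellman equation for Q^π. -/

section Chain

variable {S A : Type*} [MeasurableSpace S] [MeasurableSpace A]

lemma integrable_of_abs_le {α : Type*} [MeasurableSpace α] {μ : Measure α} [IsFiniteMeasure μ]
    {g : α → ℝ} (hg : Measurable g) {B : ℝ} (hB : ∀ x, |g x| ≤ B) : Integrable g μ :=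
  Integrable.of_bound hg.aestronglyMeasurable B (ae_of_all _ hB)

lemma abs_integral_le_of_abs_le {α : Type*} [MeasurableSpace α] {μ : Measure α}
    [IsProbabilityMeasure μ] {g : α → ℝ} {B : ℝ} (hB : ∀ x, |g x| ≤ B) : |∫ x, g x ∂μ| ≤ B := by
  simpa using norm_integral_le_of_norm_le_const (μ := μ) (f := g) (ae_of_all _ hB)

lemma integral_bind_of_abs_le {α β : Type*} [MeasurableSpace α] [MeasurableSpace β]
    {μ : Measure α} [IsProbabilityMeasure μ] (κ : Kernel α β) [IsMarkovKernel κ] {g : β → ℝ}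
    (hg : Measurable g) {B : ℝ} (hB : ∀ x, |g x| ≤ B) :
    ∫ y, g y ∂(κ ∘ₘ μ) = ∫ x, ∫ y, g y ∂κ x ∂μ := by
  rw [← Measure.snd_compProd, Measure.snd, integral_map (by fun_prop) hg.aestronglyMeasurable,
    Measure.integral_compProd]
  exact integrable_of_abs_le (hg.comp measurable_snd) fun x => hB x.2

instance (M : MDP S A) (π : Kernel S A) [IsMarkovKernel π] (μ : Measure (S × A))
    [IsProbabilityMeasure μ] : IsProbabilityMeasure (trajLaw M π μ) := by
  unfold trajLaw; infer_instance

instance (M : MDP S A) (π : Kernel S A) [IsMarkovKernel π] (ρ₀ : Measure S)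
    [IsProbabilityMeasure ρ₀] : IsProbabilityMeasure (policyLaw M π ρ₀) := by
  unfold policyLaw; infer_instance

instance (M : MDP S A) (π : Kernel S A) [IsMarkovKernel π] (ρ₀ : Measure S)
    [IsProbabilityMeasure ρ₀] (j : ℕ) : IsProbabilityMeasure (stateDist M π ρ₀ j) :=
  Measure.isProbabilityMeasure_map (measurable_pi_apply j).fst.aemeasurable

lemma trajLaw_map_zero (M : MDP S A) (π : Kernel S A) [IsMarkovKernel π] (μ : Measure (S × A))
    [IsProbabilityMeasure μ] : (trajLaw M π μ).map (fun x => x 0) = μ := by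
  have h : (trajLaw M π μ).map (Preorder.frestrictLe 0) =
      μ.map (MeasurableEquiv.piUnique (fun _ : Finset.Iic 0 => S × A)).symm := by
    rw [trajLaw, Kernel.trajMeasure, Measure.map_comp _ _ (by fun_prop),
      Kernel.traj_map_frestrictLe, Kernel.partialTraj_self, Measure.id_comp]
  have h2 := congrArg (Measure.map fun y : (_ : Finset.Iic 0) → S × A =>
    y ⟨0, Finset.mem_Iic.2 le_rfl⟩) h
  rw [Measure.map_map (by fun_prop) (by fun_prop), Measure.map_map (by fun_prop) (by fun_prop)] at h2
  refine Eq.trans ?_ (h2.trans ?_)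
  · rfl
  · exact Measure.map_id

lemma trajLaw_map_succ (M : MDP S A) (π : Kernel S A) [IsMarkovKernel π] (μ : Measure (S × A))
    [IsProbabilityMeasure μ] (j : ℕ) :
    (trajLaw M π μ).map (fun x => x (j + 1)) =
      stepKernel M π ∘ₘ (trajLaw M π μ).map (fun x => x j) := by
  have h := congrArg Measure.snd (Kernel.map_frestrictLe_trajMeasure_compProd_eq_map_trajMeasure
    (X := fun _ => S × A) (μ₀ := μ) (κ := historyKernel M π) (a := j))
  rw [Measure.snd_compProd, Measure.snd_map_prodMk (by fun_prop)] at h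
  refine Eq.trans h.symm ?_
  change _ ∘ₘ (trajLaw M π μ).map _ = _
  ext s hs
  rw [Measure.bind_apply hs (Kernel.aemeasurable _), Measure.bind_apply hs (Kernel.aemeasurable _),
    lintegral_map (Kernel.measurable_coe _ hs) (by fun_prop),
    lintegral_map (Kernel.measurable_coe _ hs) (by fun_prop)]
  rfl

/-- The `j`-fold iterate of the state-action chain under `π`. -/
noncomputable def stepIter (M : MDP S A) (π : Kernel S A) : ℕ → Kernel (S × A) (S × A)
  | 0 => Kernel.id
  | j + 1 => stepKernel M π ∘ₖ stepIter M π j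

instance (M : MDP S A) (π : Kernel S A) [IsMarkovKernel π] (j : ℕ) :
    IsMarkovKernel (stepIter M π j) := by
  induction j with
  | zero => unfold stepIter; infer_instance
  | succ j ih => unfold stepIter; infer_instance

/-- The definition appends a step at the end; the Bellman equation conditions on the first step. -/
lemma stepIter_succ' (M : MDP S A) (π : Kernel S A) [IsMarkovKernel π] (j : ℕ) :
    stepIter M π (j + 1) = stepIter M π j ∘ₖ stepKernel M π := by
  induction j with
  | zero => simp [stepIter]
  | succ j ih => rw [stepIter, ih, ← Kernel.comp_assoc, ← ih]; rfl

lemma trajLaw_map (M : MDP S A) (π : Kernel S A) [IsMarkovKernel π] (μ : Measure (S × A))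
    [IsProbabilityMeasure μ] (j : ℕ) :
    (trajLaw M π μ).map (fun x => x j) = stepIter M π j ∘ₘ μ := by
  induction j with
  | zero => rw [trajLaw_map_zero, stepIter, Measure.id_comp]
  | succ j ih => rw [trajLaw_map_succ, ih, Measure.comp_assoc]; rfl

lemma summable_discount (M : MDP S A) (B : ℝ) : Summable fun j : ℕ => M.discount ^ j * B :=
  (summable_geometric_of_lt_one M.discount_pos.le M.discount_lt_one).mul_right B

/-- Dominated convergence with the geometric majorant γ^j R moves the expectation inside the series.
Each term then depends only on a one-time marginal, which makes Q^π accessible to measurability and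
recursion arguments. -/
lemma hasSum_qFun (M : MDP S A) (π : Kernel S A) [IsMarkovKernel π] {R : ℝ}
    (hR : ∀ s a, |M.reward s a| ≤ R) (p : S × A) :
    HasSum (fun j : ℕ => M.discount ^ j * ∫ q, M.reward q.1 q.2 ∂stepIter M π j p)
      (qFun M π p.1 p.2) := by
  have hm : Measurable fun q : S × A => M.reward q.1 q.2 := M.measurable_reward
  have hb (j : ℕ) (x : ℕ → S × A) :
      ‖M.discount ^ j * M.reward (x j).1 (x j).2‖ ≤ M.discount ^ j * R := by
    rw [norm_mul, norm_pow, Real.norm_of_nonneg M.discount_pos.le]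
    exact mul_le_mul_of_nonneg_left (hR _ _) (pow_nonneg M.discount_pos.le _)
  have key := hasSum_integral_of_dominated_convergence (μ := trajLaw M π (Measure.dirac p))
    (F := fun j x => M.discount ^ j * M.reward (x j).1 (x j).2)
    (f := fun x => ∑' j : ℕ, M.discount ^ j * M.reward (x j).1 (x j).2)
    (fun j _ => M.discount ^ j * R)
    (fun j => ((hm.comp (measurable_pi_apply j)).const_mul _).aestronglyMeasurable)
    (fun j => ae_of_all _ (hb j)) (ae_of_all _ fun _ => summable_discount M R)
    (integrable_const _)
    (ae_of_all _ fun x => (Summable.of_norm_bounded (summable_discount M R) (hb · x)).hasSum)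
  have hint : (fun j : ℕ => ∫ x, M.discount ^ j * M.reward (x j).1 (x j).2
      ∂trajLaw M π (Measure.dirac p)) =
      fun j : ℕ => M.discount ^ j * ∫ q, M.reward q.1 q.2 ∂stepIter M π j p := by
    ext j
    have := trajLaw_map M π (Measure.dirac p) j
    rw [Measure.dirac_bind (Kernel.measurable _)] at this
    rw [integral_const_mul, ← this, integral_map (measurable_pi_apply j).aemeasurable
      hm.aestronglyMeasurable]
  rw [hint] at key
  exact key

lemma measurable_qFun (M : MDP S A) (π : Kernel S A) [IsMarkovKernel π] {R : ℝ}
    (hR : ∀ s a, |M.reward s a| ≤ R) : Measurable (Function.uncurry (qFun M π)) := by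
  have : Function.uncurry (qFun M π) = fun p => ∑' j : ℕ, M.discount ^ j *
      ∫ q, M.reward q.1 q.2 ∂stepIter M π j p := by
    ext p; exact (hasSum_qFun M π hR p).tsum_eq.symm
  rw [this]
  have hm : Measurable fun q : S × A => M.reward q.1 q.2 := M.measurable_reward
  refine measurable_of_tendsto_metrizable (f := fun n p => ∑ j ∈ Finset.range n, M.discount ^ j *
      ∫ q, M.reward q.1 q.2 ∂stepIter M π j p) (fun n => ?_) ?_
  · exact Finset.measurable_sum _ fun j _ =>
      (hm.stronglyMeasurable.integral_kernel.measurable).const_mul _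
  · exact tendsto_pi_nhds.2 fun p => (hasSum_qFun M π hR p).summable.hasSum.tendsto_sum_nat

lemma integral_stepKernel (M : MDP S A) (π : Kernel S A) [IsMarkovKernel π] {g : S × A → ℝ}
    (hg : Measurable g) {B : ℝ} (hB : ∀ x, |g x| ≤ B) (p : S × A) :
    ∫ q, g q ∂stepKernel M π p = ∫ s', ∫ a', g (s', a') ∂π s' ∂M.transition p := by
  rw [stepKernel, ProbabilityTheory.integral_compProd]
  · rfl
  · exact integrable_of_abs_le (μ := (M.transition ⊗ₖ Kernel.prodMkLeft (S × A) π) p) hg hB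

lemma qFun_eq (M : MDP S A) (π : Kernel S A) [IsMarkovKernel π] {R : ℝ}
    (hR : ∀ s a, |M.reward s a| ≤ R) (s : S) (a : A) :
    qFun M π s a = M.reward s a + M.discount *
      ∫ s', ∫ a', qFun M π s' a' ∂π s' ∂M.transition (s, a) := by
  have hm : Measurable fun q : S × A => M.reward q.1 q.2 := M.measurable_reward
  have hb (j : ℕ) (x : S × A) :
      |M.discount ^ j * ∫ q, M.reward q.1 q.2 ∂stepIter M π j x| ≤ M.discount ^ j * R := by
    rw [abs_mul, abs_pow, abs_of_nonneg M.discount_pos.le]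
    exact mul_le_mul_of_nonneg_left (abs_integral_le_of_abs_le fun q => hR q.1 q.2)
      (pow_nonneg M.discount_pos.le _)
  have hms (j : ℕ) : Measurable fun x : S × A => M.discount ^ j *
      ∫ q, M.reward q.1 q.2 ∂stepIter M π j x :=
    (hm.stronglyMeasurable.integral_kernel.measurable).const_mul _
  have hqb (p : S × A) : |qFun M π p.1 p.2| ≤ ∑' j : ℕ, M.discount ^ j * R := by
    rw [← (hasSum_qFun M π hR p).tsum_eq]
    exact tsum_of_norm_bounded (f := fun j : ℕ => M.discount ^ j *
      ∫ q, M.reward q.1 q.2 ∂stepIter M π j p) (summable_discount M R).hasSum fun j => hb j p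
  have hint := integral_stepKernel M π (measurable_qFun M π hR) hqb (s, a)
  have key := hasSum_integral_of_dominated_convergence (μ := stepKernel M π (s, a))
    (F := fun j x => M.discount ^ j * ∫ q, M.reward q.1 q.2 ∂stepIter M π j x)
    (f := fun x => qFun M π x.1 x.2)
    (fun j _ => M.discount ^ j * R)
    (fun j => (hms j).aestronglyMeasurable)
    (fun j => ae_of_all _ (hb j)) (ae_of_all _ fun _ => summable_discount M R)
    (integrable_const _) (ae_of_all _ fun x => hasSum_qFun M π hR x)
  have h1 := (key.mul_left M.discount)
  have h2 := (hasSum_nat_add_iff' 1).2 (hasSum_qFun M π hR (s, a))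
  -- Averaging the j-th term over one initial transition gives the (j+1)-st term, so this series is
  -- the Q-series with its first term removed.
  have h3 : (fun j : ℕ => M.discount * ∫ x, M.discount ^ j *
      ∫ q, M.reward q.1 q.2 ∂stepIter M π j x ∂stepKernel M π (s, a)) =
      fun j : ℕ => M.discount ^ (j + 1) *
        ∫ q, M.reward q.1 q.2 ∂stepIter M π (j + 1) (s, a) := by
    ext j
    rw [integral_const_mul, stepIter_succ', Kernel.integral_comp]
    · ring
    · exact integrable_of_abs_le hm fun q => hR q.1 q.2
  rw [h3] at h1
  have h4 := h1.unique h2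
  simp only [Finset.range_one, Finset.sum_singleton, pow_zero, one_mul, stepIter, Kernel.id_apply,
    integral_dirac' _ _ hm.stronglyMeasurable] at h4
  change ∫ q, qFun M π q.1 q.2 ∂stepKernel M π (s, a) = _ at hint
  rw [hint] at h4
  simp only [Function.uncurry_apply_pair] at h4
  linarith

/-- The law of the state-action pair at step `j` is the state distribution extended by `π`. -/
lemma policyLaw_map (M : MDP S A) (π : Kernel S A) [IsMarkovKernel π] (ρ₀ : Measure S)
    [IsProbabilityMeasure ρ₀] (j : ℕ) :
    (policyLaw M π ρ₀).map (fun x => x j) = stateDist M π ρ₀ j ⊗ₘ π := by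
  have hfst (j : ℕ) : ((policyLaw M π ρ₀).map fun x => x j).fst = stateDist M π ρ₀ j := by
    rw [Measure.fst, Measure.map_map (by fun_prop) (by fun_prop)]; rfl
  -- Any state law μ will do: comparing first marginals identifies it as the state distribution.
  suffices h : ∃ μ : Measure S, IsProbabilityMeasure μ ∧
      (policyLaw M π ρ₀).map (fun x => x j) = μ ⊗ₘ π by
    obtain ⟨μ, _, h⟩ := h
    rw [← hfst, h, Measure.fst_compProd]
  cases j with
  | zero => exact ⟨ρ₀, inferInstance, trajLaw_map_zero M π _⟩
  | succ j =>
    have : IsProbabilityMeasure ((policyLaw M π ρ₀).map fun x => x j) :=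
      Measure.isProbabilityMeasure_map (measurable_pi_apply j).aemeasurable
    refine ⟨M.transition ∘ₘ (policyLaw M π ρ₀).map (fun x => x j), inferInstance, ?_⟩
    refine (trajLaw_map_succ M π _ j).trans ?_
    change _ ∘ₘ (policyLaw M π ρ₀).map (fun x => x j) = _
    generalize (policyLaw M π ρ₀).map (fun x => x j) = ν at *
    ext s hs
    rw [Measure.bind_apply hs (Kernel.aemeasurable _), Measure.compProd_apply hs,
      Measure.lintegral_bind (Kernel.aemeasurable _)
        (Kernel.measurable_kernel_prodMk_left hs).aemeasurable]
    refine lintegral_congr fun p => ?_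
    rw [stepKernel, Kernel.compProd_apply hs]
    rfl

lemma integral_stateDist_succ (M : MDP S A) (π : Kernel S A) [IsMarkovKernel π] (ρ₀ : Measure S)
    [IsProbabilityMeasure ρ₀] (j : ℕ) {g : S → ℝ} (hg : Measurable g) {B : ℝ}
    (hB : ∀ x, |g x| ≤ B) :
    ∫ s, g s ∂stateDist M π ρ₀ (j + 1) =
      ∫ p, ∫ s', g s' ∂M.transition p ∂(stateDist M π ρ₀ j ⊗ₘ π) := by
  have h1 : ∫ s, g s ∂stateDist M π ρ₀ (j + 1) =
      ∫ p, g p.1 ∂(policyLaw M π ρ₀).map (fun x => x (j + 1)) := by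
    rw [stateDist, integral_map (measurable_pi_apply _).fst.aemeasurable hg.aestronglyMeasurable,
      integral_map (measurable_pi_apply _).aemeasurable
        (hg.comp measurable_fst).aestronglyMeasurable]
  have h2 : (policyLaw M π ρ₀).map (fun x => x (j + 1)) =
      stepKernel M π ∘ₘ (policyLaw M π ρ₀).map (fun x => x j) := trajLaw_map_succ M π _ j
  rw [h1, h2, policyLaw_map, integral_bind_of_abs_le (g := fun p : S × A => g p.1) _
    (hg.comp measurable_fst) fun x => hB x.1]
  refine integral_congr_ae (ae_of_all _ fun p => ?_)
  exact (integral_stepKernel M π (hg.comp measurable_fst) (fun x => hB x.1) p).trans (by simp)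

end Chain

/-! ### Occupancy measures and the mixture identity for the behavior policy. -/

section Mixture

variable {S A : Type*} [MeasurableSpace S] [MeasurableSpace A] {n : ℕ}

instance (M : MDP S A) (π : Kernel S A) [IsMarkovKernel π] (ρ₀ : Measure S)
    [IsProbabilityMeasure ρ₀] (i : ℕ) : IsProbabilityMeasure (occupancy M π ρ₀ i) := by
  have h0 : 0 < 1 - M.discount := sub_pos.2 M.discount_lt_one
  have h : HasSum (fun k : ℕ => (1 - M.discount) * M.discount ^ k) 1 := by
    have := (hasSum_geometric_of_lt_one M.discount_pos.le M.discount_lt_one).mul_left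
      (1 - M.discount)
    rwa [mul_inv_cancel₀ h0.ne'] at this
  refine ⟨?_⟩
  simp only [occupancy, Measure.sum_apply _ MeasurableSet.univ, Measure.smul_apply, measure_univ,
    smul_eq_mul, mul_one]
  rw [← ENNReal.ofReal_tsum_of_nonneg
    (fun k => mul_nonneg h0.le (pow_nonneg M.discount_pos.le k)) h.summable, h.tsum_eq,
    ENNReal.ofReal_one]

lemma hasSum_integral_occupancy (M : MDP S A) (π : Kernel S A) [IsMarkovKernel π] (ρ₀ : Measure S)
    [IsProbabilityMeasure ρ₀] (i : ℕ) {g : S × A → ℝ} (hg : Measurable g) {B : ℝ}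
    (hB : ∀ x, |g x| ≤ B) :
    HasSum (fun k => (1 - M.discount) * M.discount ^ k *
      ∫ p, g p ∂(stateDist M π ρ₀ (i + k) ⊗ₘ π)) (∫ p, g p ∂(occupancy M π ρ₀ i ⊗ₘ π)) := by
  have h : occupancy M π ρ₀ i ⊗ₘ π = Measure.sum fun k : ℕ =>
      ENNReal.ofReal ((1 - M.discount) * M.discount ^ k) • (stateDist M π ρ₀ (i + k) ⊗ₘ π) := by
    rw [occupancy, Measure.compProd_sum_left]
    simp only [Measure.compProd_smul_left]
  have hi : Integrable g (occupancy M π ρ₀ i ⊗ₘ π) := integrable_of_abs_le hg hB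
  rw [h] at hi ⊢
  have := hasSum_integral_measure hi
  simp only [integral_smul_measure, smul_eq_mul] at this
  simpa only [ENNReal.toReal_ofReal (mul_nonneg (sub_nonneg.2 M.discount_lt_one.le)
    (pow_nonneg M.discount_pos.le _))] using this

/-- The mixture of the occupancy measures, each extended by its own policy, is the extension of the
mixture of the occupancy measures by the behavior policy. -/
lemma sum_occupancy_compProd (M : MDP S A) (ρ₀ : Measure S) [IsProbabilityMeasure ρ₀]
    (π : Fin (n + 1) → Kernel S A) [∀ e, IsMarkovKernel (π e)] (w : Fin (n + 1) → ℝ) (i : ℕ) :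
    ∑ e, ENNReal.ofReal (w e) • (occupancy M (π e) ρ₀ i ⊗ₘ π e) =
      ∑ e, ENNReal.ofReal (w e) • (occupancy M (π e) ρ₀ i ⊗ₘ behaviorPolicy M ρ₀ π w i) := by
  set ν := ∑ e, occupancy M (π e) ρ₀ i with hν
  have hac (e) : occupancy M (π e) ρ₀ i ≪ ν :=
    Measure.absolutelyContinuous_of_le
      (Finset.single_le_sum (f := fun e => occupancy M (π e) ρ₀ i) (fun _ _ => Measure.zero_le _)
        (Finset.mem_univ e))
  have hd (e) : Measurable (weightedDensity M ρ₀ π w i e) :=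
    (Measure.measurable_rnDeriv _ _).const_mul _
  have hlint {f : Fin (n + 1) → S → ℝ≥0∞} (hf : ∀ e, Measurable (f e)) :
      ∑ e, ENNReal.ofReal (w e) * ∫⁻ s, f e s ∂occupancy M (π e) ρ₀ i =
        ∫⁻ s, ∑ e, weightedDensity M ρ₀ π w i e s * f e s ∂ν := by
    rw [lintegral_finsetSum _ fun e _ => (hd e).fun_mul (hf e)]
    refine Finset.sum_congr rfl fun e _ => ?_
    rw [← lintegral_rnDeriv_mul (hac e) (hf e).aemeasurable, ← lintegral_const_mul _
      ((Measure.measurable_rnDeriv _ _).fun_mul (hf e))]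
    simp only [weightedDensity, mul_assoc, hν]
  have hfin : ∀ᵐ s ∂ν, ∀ e, weightedDensity M ρ₀ π w i e s ≠ ∞ := by
    refine ae_all_iff.2 fun e => ?_
    filter_upwards [Measure.rnDeriv_ne_top (occupancy M (π e) ρ₀ i) ν] with s hs
    exact ENNReal.mul_ne_top ENNReal.ofReal_ne_top hs
  ext t ht
  simp only [Measure.finsetSum_apply, Measure.smul_apply, smul_eq_mul, Measure.compProd_apply ht]
  rw [hlint fun e => Kernel.measurable_kernel_prodMk_left ht,
    hlint fun e => Kernel.measurable_kernel_prodMk_left ht]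
  refine lintegral_congr_ae ?_
  filter_upwards [hfin] with s hs
  rw [← Finset.sum_mul]
  have htop : ∑ e, weightedDensity M ρ₀ π w i e s ≠ ∞ := ENNReal.sum_ne_top.2 fun e _ => hs e
  -- Where the total density is zero every summand on both sides vanishes, and it is infinite only
  -- on a null set. The fallback value of the behavior policy therefore plays no role.
  by_cases h0 : ∑ e, weightedDensity M ρ₀ π w i e s = 0
  · rw [h0, zero_mul]
    rw [Finset.sum_eq_zero_iff] at h0
    exact Finset.sum_eq_zero fun e he => by rw [h0 e he, zero_mul]
  · have hb : behaviorPolicy M ρ₀ π w i s = ∑ e, (weightedDensity M ρ₀ π w i e s /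
        ∑ e', weightedDensity M ρ₀ π w i e' s) • π e s := by
      change ite _ _ _ = _
      rw [if_neg]
      exact not_or.2 ⟨h0, htop⟩
    rw [hb]
    simp only [Measure.finsetSum_apply, Measure.smul_apply, smul_eq_mul]
    rw [Finset.mul_sum]
    refine Finset.sum_congr rfl fun e _ => ?_
    rw [← mul_assoc, ENNReal.mul_div_cancel h0 htop]

/-- Obtained by integrating g against both sides of `sum_occupancy_compProd` and expanding each
occupancy measure as its discounted series. The cancellation holds only after summing over all steps
and episodes. -/
lemma hasSum_behaviorPolicy_sub (M : MDP S A) (ρ₀ : Measure S) [IsProbabilityMeasure ρ₀]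
    (π : Fin (n + 1) → Kernel S A) [∀ e, IsMarkovKernel (π e)] {w : Fin (n + 1) → ℝ}
    (hw : ∀ e, 0 ≤ w e) (i : ℕ) {g : S × A → ℝ} (hg : Measurable g) {B : ℝ}
    (hB : ∀ x, |g x| ≤ B) :
    HasSum (fun k => M.discount ^ k * ∑ e, w e *
      (∫ s, ∫ a, g (s, a) ∂behaviorPolicy M ρ₀ π w i s ∂stateDist M (π e) ρ₀ (i + k) -
        ∫ p, g p ∂(stateDist M (π e) ρ₀ (i + k) ⊗ₘ π e))) 0 := by
  set β := behaviorPolicy M ρ₀ π w i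
  have hf : Measurable fun s => ∫ a, g (s, a) ∂β s :=
    hg.stronglyMeasurable.integral_kernel_prod_right'.measurable
  have hfB (s) : |∫ a, g (s, a) ∂β s| ≤ B := abs_integral_le_of_abs_le fun a => hB (s, a)
  have hconst (μ : Measure S) [IsProbabilityMeasure μ] (e) :
      ∫ p, (∫ a, g (p.1, a) ∂β p.1) ∂(μ ⊗ₘ π e) = ∫ s, ∫ a, g (s, a) ∂β s ∂μ := by
    rw [Measure.integral_compProd (f := fun p : S × A => ∫ a, g (p.1, a) ∂β p.1)
      (integrable_of_abs_le (hf.comp measurable_fst) fun p => hfB p.1)]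
    simp
  have hmix := congrArg (fun μ => ∫ p, g p ∂μ) (sum_occupancy_compProd M ρ₀ π w i)
  beta_reduce at hmix
  rw [integral_finsetSum_measure fun e _ => (integrable_of_abs_le hg hB).smul_measure
      ENNReal.ofReal_ne_top,
    integral_finsetSum_measure fun e _ => (integrable_of_abs_le hg hB).smul_measure
      ENNReal.ofReal_ne_top] at hmix
  simp only [integral_smul_measure, ENNReal.toReal_ofReal (hw _), smul_eq_mul] at hmix
  have h1 (e) := hasSum_integral_occupancy M (π e) ρ₀ i hg hB
  have h2 (e) := hasSum_integral_occupancy M (π e) ρ₀ i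
    (g := fun p => ∫ a, g (p.1, a) ∂β p.1) (hf.comp measurable_fst) fun p => hfB p.1
  have h3 := hasSum_sum (s := Finset.univ) fun e _ => ((h2 e).sub (h1 e)).mul_left (w e)
  have h4 : ∑ e, w e * (∫ p, (∫ a, g (p.1, a) ∂β p.1) ∂(occupancy M (π e) ρ₀ i ⊗ₘ π e) -
      ∫ p, g p ∂(occupancy M (π e) ρ₀ i ⊗ₘ π e)) = 0 := by
    simp only [mul_sub, Finset.sum_sub_distrib, hmix, hconst]
    refine sub_eq_zero.2 (Finset.sum_congr rfl fun e _ => ?_)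
    rw [Measure.integral_compProd (integrable_of_abs_le hg hB)]
  rw [h4] at h3
  have h5 := h3.mul_left (1 - M.discount)⁻¹
  rw [mul_zero] at h5
  refine (congrArg (HasSum · 0) (funext fun k => ?_)).mpr h5
  have h0 : 1 - M.discount ≠ 0 := (sub_pos.2 M.discount_lt_one).ne'
  rw [Finset.mul_sum, Finset.mul_sum]
  refine Finset.sum_congr rfl fun e _ => ?_
  rw [hconst]
  field_simp

end Mixture

/-! ### Wasserstein duality, Hoeffding's inequality, and the telescoping recursion. -/

section Tools

lemma wasserstein1_nonneg {A : Type*} [MeasurableSpace A] [PseudoEMetricSpace A]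
    (μ ν : Measure A) : 0 ≤ wasserstein1 μ ν := ENNReal.toReal_nonneg

/-- The easy half of Kantorovich duality, on a bounded space. -/
lemma integral_sub_integral_le_wasserstein1 {A : Type*} [MeasurableSpace A] [PseudoMetricSpace A]
    [OpensMeasurableSpace A] (hA : Bornology.IsBounded (Set.univ : Set A))
    (μ ν : Measure A) [IsProbabilityMeasure μ] [IsProbabilityMeasure ν] {φ : A → ℝ} {K : ℝ≥0}
    (hφ : LipschitzWith K φ) {B : ℝ} (hB : ∀ a, |φ a| ≤ B) :
    ∫ a, φ a ∂μ - ∫ a, φ a ∂ν ≤ K * wasserstein1 μ ν := by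
  have hm : Measurable φ := hφ.continuous.measurable
  -- Finiteness matters because `toReal` sends `∞` to 0. The product coupling costs at most the
  -- diameter.
  have hW : (⨅ Γ ∈ {Γ : Measure (A × A) | Γ.map Prod.fst = μ ∧ Γ.map Prod.snd = ν},
      ∫⁻ p, edist p.1 p.2 ∂Γ) ≠ ∞ := by
    refine ne_top_of_le_ne_top (b := ENNReal.ofReal (Metric.diam (Set.univ : Set A)))
      ENNReal.ofReal_ne_top (iInf₂_le_of_le (μ.prod ν) ⟨?_, ?_⟩ ?_)
    · rw [← Measure.fst, Measure.fst_prod]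
    · rw [← Measure.snd, Measure.snd_prod]
    · refine (lintegral_mono (g := fun _ => ENNReal.ofReal (Metric.diam (Set.univ : Set A)))
        fun p => ?_).trans_eq (by simp)
      rw [edist_dist]
      exact ENNReal.ofReal_le_ofReal
        (Metric.dist_le_diam_of_mem hA (Set.mem_univ _) (Set.mem_univ _))
  have hΓ (Γ : Measure (A × A)) (h : Γ.map Prod.fst = μ ∧ Γ.map Prod.snd = ν) :
      ENNReal.ofReal (∫ a, φ a ∂μ - ∫ a, φ a ∂ν) ≤ K * ∫⁻ p, edist p.1 p.2 ∂Γ := by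
    have : IsProbabilityMeasure Γ := by
      refine ⟨?_⟩
      rw [← Set.preimage_univ (f := (Prod.fst : A × A → A)),
        ← Measure.map_apply measurable_fst .univ, h.1, measure_univ]
    rw [← h.1, ← h.2, integral_map (by fun_prop) hm.aestronglyMeasurable,
      integral_map (by fun_prop) hm.aestronglyMeasurable, ← integral_sub
        (f := fun p : A × A => φ p.1) (g := fun p : A × A => φ p.2)
        (integrable_of_abs_le (hm.comp measurable_fst) fun p => hB p.1)
        (integrable_of_abs_le (hm.comp measurable_snd) fun p => hB p.2)]
    calc ENNReal.ofReal (∫ p, (φ p.1 - φ p.2) ∂Γ)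
        ≤ ‖∫ p, (φ p.1 - φ p.2) ∂Γ‖ₑ := by
          rw [← ofReal_norm]; exact ENNReal.ofReal_le_ofReal (le_abs_self _)
      _ ≤ ∫⁻ p, ‖φ p.1 - φ p.2‖ₑ ∂Γ := enorm_integral_le_lintegral_enorm _
      _ ≤ ∫⁻ p, K * edist p.1 p.2 ∂Γ := lintegral_mono fun p => by
          rw [← edist_eq_enorm_sub]; exact hφ p.1 p.2
      _ = K * ∫⁻ p, edist p.1 p.2 ∂Γ := lintegral_const_mul' _ _ ENNReal.coe_ne_top
  -- The infimum is reached by dividing by K, so K = 0 is treated separately, with the product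
  -- coupling.
  rcases eq_or_ne K 0 with rfl | hK
  · have := hΓ (μ.prod ν) ⟨by rw [← Measure.fst, Measure.fst_prod],
      by rw [← Measure.snd, Measure.snd_prod]⟩
    simpa using this
  · have h1 : ENNReal.ofReal (∫ a, φ a ∂μ - ∫ a, φ a ∂ν) / K ≤
        ⨅ Γ ∈ {Γ : Measure (A × A) | Γ.map Prod.fst = μ ∧ Γ.map Prod.snd = ν},
          ∫⁻ p, edist p.1 p.2 ∂Γ :=
      le_iInf₂ fun Γ h => ENNReal.div_le_of_le_mul' (hΓ Γ h)
    have h2 := (ENNReal.div_le_iff_le_mul (Or.inl (by exact_mod_cast hK))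
      (Or.inl ENNReal.coe_ne_top)).1 h1
    have h3 := (ENNReal.ofReal_le_iff_le_toReal (ENNReal.mul_ne_top hW ENNReal.coe_ne_top)).1 h2
    rwa [ENNReal.toReal_mul, ENNReal.coe_toReal, mul_comm] at h3

/-- One-sided Hoeffding bound: with probability greater than `1 - δ`, a sum of independent
nonnegative bounded variables is not much below its expectation. -/
lemma exists_event_sum_integral_le {Ω ι : Type*} [MeasurableSpace Ω] [Fintype ι] {P : Measure Ω}
    [IsProbabilityMeasure P] {Z : ι → Ω → ℝ} (hind : iIndepFun Z P)
    (hm : ∀ e, AEMeasurable (Z e) P) {b : ι → ℝ} (hZ : ∀ e ω, Z e ω ∈ Set.Icc 0 (b e))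
    {δ : ℝ} (hδ₀ : 0 < δ) (hδ₁ : δ < 1) :
    ∃ E : Set Ω, MeasurableSet E ∧ 1 - δ < P.real E ∧ ∀ ω ∈ E,
      ∑ e, ∫ ω', Z e ω' ∂P ≤ ∑ e, Z e ω + √((∑ e, b e ^ 2) / 2 * Real.log (2 / δ)) := by
  have hlog : 0 < Real.log (2 / δ) := Real.log_pos (by rw [lt_div_iff₀ hδ₀]; linarith)
  -- If all ranges are zero the variance proxy vanishes and the exponential bound is void, but then
  -- every variable is identically 0.
  rcases (Finset.sum_nonneg fun e (_ : e ∈ Finset.univ) => sq_nonneg (b e)).eq_or_lt with hb | hb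
  · refine ⟨Set.univ, .univ, by simpa using hδ₀, fun ω _ => ?_⟩
    have h0 (e : ι) : b e = 0 :=
      pow_eq_zero_iff two_ne_zero |>.1
        ((Finset.sum_eq_zero_iff_of_nonneg fun e _ => sq_nonneg (b e)).1 hb.symm e
          (Finset.mem_univ e))
    have hZ0 (e : ι) (ω : Ω) : Z e ω = 0 := le_antisymm (h0 e ▸ (hZ e ω).2) (hZ e ω).1
    simp [hZ0]
  · set t := √((∑ e, b e ^ 2) / 2 * Real.log (2 / δ)) with ht
    have hind' : iIndepFun (fun e ω => -Z e ω - ∫ ω', -Z e ω' ∂P) P :=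
      hind.comp (fun e x => -x - ∫ ω', -Z e ω' ∂P) fun e => by fun_prop
    have hsub (e : ι) : HasSubgaussianMGF (fun ω => -Z e ω - ∫ ω', -Z e ω' ∂P)
        ((‖0 - -b e‖₊ / 2) ^ 2) P :=
      hasSubgaussianMGF_of_mem_Icc (hm e).neg
        (ae_of_all _ fun ω => ⟨neg_le_neg (hZ e ω).2, neg_nonpos.2 (hZ e ω).1⟩)
    have hH := HasSubgaussianMGF.measure_sum_ge_le_of_iIndepFun hind' (s := Finset.univ)
      (fun e _ => hsub e) (Real.sqrt_nonneg _ : 0 ≤ t)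
    -- The threshold t makes the one-sided failure probability at most δ/2, which leaves room for
    -- the strict inequality 1 - δ < P(E).
    have hexp : Real.exp (-t ^ 2 / (2 * ∑ e, ((‖0 - -b e‖₊ / 2) ^ 2 : ℝ≥0))) = δ / 2 := by
      have h1 : (((∑ e, (‖0 - -b e‖₊ / 2) ^ 2 : ℝ≥0)) : ℝ) = (∑ e, b e ^ 2) / 4 := by
        push_cast
        rw [Finset.sum_div]
        refine Finset.sum_congr rfl fun e _ => ?_
        rw [zero_sub, neg_neg, div_pow, Real.norm_eq_abs, sq_abs]
        norm_num
      rw [h1, ht, Real.sq_sqrt (by positivity)]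
      have h2 : -((∑ e, b e ^ 2) / 2 * Real.log (2 / δ)) / (2 * ((∑ e, b e ^ 2) / 4)) =
          Real.log (δ / 2) := by
        rw [← inv_div δ 2, Real.log_inv]
        field_simp
        ring
      rw [h2, Real.exp_log (by positivity)]
    rw [hexp] at hH
    set bad := {ω | t ≤ ∑ e, (-Z e ω - ∫ ω', -Z e ω' ∂P)}
    -- The variables are only a.e.-measurable, so the bad event is enlarged to a measurable set of
    -- the same measure.
    refine ⟨(toMeasurable P bad)ᶜ, (measurableSet_toMeasurable _ _).compl, ?_, fun ω hω => ?_⟩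
    · have h3 : P.real (toMeasurable P bad) = P.real bad := by
        simp [Measure.real, measure_toMeasurable]
      rw [probReal_compl_eq_one_sub (measurableSet_toMeasurable _ _), h3]
      linarith
    · have h4 : ω ∉ bad := fun h => hω (subset_toMeasurable P bad h)
      have h5 : ∑ e, (-Z e ω - ∫ ω', -Z e ω' ∂P) < t := not_le.1 h4
      simp only [integral_neg, Finset.sum_sub_distrib, Finset.sum_neg_distrib] at h5
      linarith

/-- Write a_k + d_k = (a_k - b_k) + d_k + b_k and apply the recursion to b_k, repeatedly. The
partial sum of γ^k (a_k - b_k) is minus the tail of a series with sum zero, so a lower bound on the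
differences is what controls it from above. -/
lemma telescoping_bound {γ V K : ℝ} (hγ₀ : 0 ≤ γ) (hγ₁ : γ < 1) {a b c d : ℕ → ℝ}
    (hsum : HasSum (fun k => γ ^ k * (a k - b k)) 0) (hK : ∀ k, -K ≤ a k - b k)
    (hstep : ∀ k, b k ≤ c k + γ * (a (k + 1) + d (k + 1))) (hd : 0 ≤ d 0)
    (hV : ∀ k, a k + d k ≤ V) (m : ℕ) :
    a 0 ≤ ∑ k ∈ Finset.range m, γ ^ k * (c k + d k) + γ ^ m * V + K * γ ^ m / (1 - γ) := by
  have h1 (m : ℕ) : a 0 + d 0 ≤ ∑ k ∈ Finset.range m, γ ^ k * (c k + d k) +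
      ∑ k ∈ Finset.range m, γ ^ k * (a k - b k) + γ ^ m * (a m + d m) := by
    induction m with
    | zero => simp
    | succ m ih =>
      rw [Finset.sum_range_succ, Finset.sum_range_succ, pow_succ]
      nlinarith [mul_le_mul_of_nonneg_left (hstep m) (pow_nonneg hγ₀ m)]
  have h2 := (hasSum_nat_add_iff' m).2 hsum
  have h3 := (hasSum_geometric_of_lt_one hγ₀ hγ₁).mul_left (γ ^ m * -K)
  have h4 := hasSum_le (fun k => ?_) h3 h2
  · have h5 := mul_le_mul_of_nonneg_left (hV m) (pow_nonneg hγ₀ m)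
    have h6 : γ ^ m * -K * (1 - γ)⁻¹ = -(K * γ ^ m / (1 - γ)) := by rw [div_eq_mul_inv]; ring
    linarith [h1 m]
  · rw [pow_add, mul_comm (γ ^ k), mul_right_comm]
    exact mul_le_mul_of_nonneg_left (hK _)
      (mul_nonneg (pow_nonneg hγ₀ _) (pow_nonneg hγ₀ _)) |>.trans_eq' (by ring)

end Tools

/-! ### Pointwise error estimates and the deterministic evaluation bound. -/

section Evaluation

variable {S A : Type*} [MeasurableSpace S] [MeasurableSpace A] {n : ℕ}

/-- The pointwise policy evaluation error `|Q - Q^π|`. -/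
noncomputable def evalGap (M : MDP S A) (π : Kernel S A) [IsMarkovKernel π] (Q : S → A → ℝ)
    (p : S × A) : ℝ :=
  |Q p.1 p.2 - qFun M π p.1 p.2|

/-- The pointwise Bellman error `|Q - B^π Q|`. -/
noncomputable def bellmanGap (M : MDP S A) (π : Kernel S A) (Q : S → A → ℝ) (p : S × A) : ℝ :=
  |Q p.1 p.2 - bellman M π Q p.1 p.2|

/-- The positive part of the increase of the conditional mean of `g` when the policy `η` is
replaced by `κ`. -/
noncomputable def policyGap (κ η : Kernel S A) (g : S × A → ℝ) (s : S) : ℝ :=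
  max 0 (∫ a, g (s, a) ∂κ s - ∫ a, g (s, a) ∂η s)

lemma policyGap_nonneg (κ η : Kernel S A) (g : S × A → ℝ) (s : S) : 0 ≤ policyGap κ η g s :=
  le_max_left _ _

lemma le_add_policyGap (κ η : Kernel S A) (g : S × A → ℝ) (s : S) :
    ∫ a, g (s, a) ∂κ s ≤ ∫ a, g (s, a) ∂η s + policyGap κ η g s := by
  linarith [le_max_right 0 (∫ a, g (s, a) ∂κ s - ∫ a, g (s, a) ∂η s),
    show policyGap κ η g s = max 0 (∫ a, g (s, a) ∂κ s - ∫ a, g (s, a) ∂η s) from rfl]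

lemma measurable_integral_kernel {κ : Kernel S A} [IsMarkovKernel κ] {g : S × A → ℝ}
    (hg : Measurable g) : Measurable fun s => ∫ a, g (s, a) ∂κ s :=
  hg.stronglyMeasurable.integral_kernel_prod_right'.measurable

lemma measurable_policyGap {κ η : Kernel S A} [IsMarkovKernel κ] [IsMarkovKernel η]
    {g : S × A → ℝ} (hg : Measurable g) : Measurable (policyGap κ η g) :=
  measurable_const.max ((measurable_integral_kernel hg).sub (measurable_integral_kernel hg))

lemma integral_mem_Icc {α : Type*} [MeasurableSpace α] {μ : Measure α} [IsProbabilityMeasure μ]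
    {g : α → ℝ} (hg : Measurable g) {B C : ℝ} (hB : ∀ x, g x ∈ Set.Icc B C) :
    ∫ x, g x ∂μ ∈ Set.Icc B C := by
  have hi : Integrable g μ := Integrable.of_mem_Icc B C hg.aemeasurable (ae_of_all _ hB)
  constructor
  · simpa using integral_mono (integrable_const (μ := μ) B) hi fun x => (hB x).1
  · simpa using integral_mono hi (integrable_const (μ := μ) C) fun x => (hB x).2

/-- The left side is the larger of the two conditional means. This keeps the telescoping remainder
at V rather than 2V. -/
lemma add_policyGap_le {κ η : Kernel S A} [IsMarkovKernel κ] [IsMarkovKernel η]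
    {g : S × A → ℝ} (hg : Measurable g) {V : ℝ} (hV : ∀ p, g p ∈ Set.Icc 0 V) (s : S) :
    ∫ a, g (s, a) ∂η s + policyGap κ η g s ≤ V := by
  have h1 := integral_mem_Icc (μ := κ s) (hg.comp measurable_prodMk_left) fun a => hV (s, a)
  have h2 := integral_mem_Icc (μ := η s) (hg.comp measurable_prodMk_left) fun a => hV (s, a)
  simp only [Function.comp_apply] at h1 h2
  rcases max_cases 0 (∫ a, g (s, a) ∂κ s - ∫ a, g (s, a) ∂η s) with h | h <;>
    · rw [policyGap, h.1]
      linarith [h1.2, h2.2]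

lemma abs_le_of_mem_Icc {x V : ℝ} (h : x ∈ Set.Icc 0 V) : |x| ≤ V := by
  rw [abs_of_nonneg h.1]; exact h.2

lemma measurable_evalGap (M : MDP S A) (π : Kernel S A) [IsMarkovKernel π] {R : ℝ}
    (hR : ∀ s a, |M.reward s a| ≤ R) {Q : S → A → ℝ} (hQ : Measurable (Function.uncurry Q)) :
    Measurable (evalGap M π Q) :=
  (hQ.sub (measurable_qFun M π hR)).abs

lemma evalGap_mem_Icc {M : MDP S A} {π : Kernel S A} [IsMarkovKernel π] {Q : S → A → ℝ} {V : ℝ}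
    (hQ : ∀ s a, Q s a ∈ Set.Icc 0 V) (hq : ∀ s a, qFun M π s a ∈ Set.Icc 0 V) (p : S × A) :
    evalGap M π Q p ∈ Set.Icc 0 V :=
  ⟨abs_nonneg _, abs_sub_le_iff.2 ⟨by linarith [(hQ p.1 p.2).2, (hq p.1 p.2).1],
    by linarith [(hQ p.1 p.2).1, (hq p.1 p.2).2]⟩⟩

lemma bellman_eq (M : MDP S A) (π : Kernel S A) [IsMarkovKernel π] {Q : S → A → ℝ}
    (hQ : Measurable (Function.uncurry Q)) {V : ℝ} (hV : ∀ s a, |Q s a| ≤ V) (p : S × A) :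
    bellman M π Q p.1 p.2 =
      M.reward p.1 p.2 + M.discount * ∫ q, Q q.1 q.2 ∂stepKernel M π p := by
  rw [integral_stepKernel M π (g := fun q => Q q.1 q.2) hQ fun q => hV q.1 q.2]; rfl

lemma measurable_bellmanGap (M : MDP S A) (π : Kernel S A) [IsMarkovKernel π] {Q : S → A → ℝ}
    (hQ : Measurable (Function.uncurry Q)) {V : ℝ} (hV : ∀ s a, |Q s a| ≤ V) :
    Measurable (bellmanGap M π Q) := by
  unfold bellmanGap
  simp only [bellman_eq M π hQ hV]
  have hQ' : Measurable fun q : S × A => Q q.1 q.2 := hQ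
  exact (hQ'.sub (M.measurable_reward.add
    (hQ'.stronglyMeasurable.integral_kernel.measurable.const_mul _))).abs

/-- The evaluation error decomposes as the Bellman residual plus a discounted propagated error. -/
lemma sub_qFun_eq (M : MDP S A) (π : Kernel S A) [IsMarkovKernel π] {R : ℝ}
    (hR : ∀ s a, |M.reward s a| ≤ R) {Q : S → A → ℝ} (hQ : Measurable (Function.uncurry Q))
    {V : ℝ} (hV : ∀ s a, |Q s a| ≤ V) (hqV : ∀ s a, |qFun M π s a| ≤ V) (p : S × A) :
    Q p.1 p.2 - qFun M π p.1 p.2 = (Q p.1 p.2 - bellman M π Q p.1 p.2) +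
      M.discount * ∫ q, (Q q.1 q.2 - qFun M π q.1 q.2) ∂stepKernel M π p := by
  have hqm := measurable_qFun M π hR
  have h1 : qFun M π p.1 p.2 = M.reward p.1 p.2 +
      M.discount * ∫ q, qFun M π q.1 q.2 ∂stepKernel M π p := by
    rw [integral_stepKernel M π (g := fun q => qFun M π q.1 q.2) hqm fun q => hqV q.1 q.2]
    exact qFun_eq M π hR p.1 p.2
  rw [integral_sub (f := fun q : S × A => Q q.1 q.2) (g := fun q : S × A => qFun M π q.1 q.2)
    (integrable_of_abs_le hQ fun q => hV q.1 q.2)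
    (integrable_of_abs_le hqm fun q => hqV q.1 q.2), bellman_eq M π hQ hV p, h1]
  ring

lemma evalGap_le (M : MDP S A) (π : Kernel S A) [IsMarkovKernel π] {R : ℝ}
    (hR : ∀ s a, |M.reward s a| ≤ R) {Q : S → A → ℝ} (hQ : Measurable (Function.uncurry Q))
    {V : ℝ} (hV : ∀ s a, Q s a ∈ Set.Icc 0 V) (hqV : ∀ s a, qFun M π s a ∈ Set.Icc 0 V)
    (p : S × A) :
    evalGap M π Q p ≤ bellmanGap M π Q p +
      M.discount * ∫ s', ∫ a', evalGap M π Q (s', a') ∂π s' ∂M.transition p := by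
  rw [← integral_stepKernel M π (measurable_evalGap M π hR hQ)
    fun q => abs_le_of_mem_Icc (evalGap_mem_Icc hV hqV q), evalGap, sub_qFun_eq M π hR hQ
      (fun s a => abs_le_of_mem_Icc (hV s a)) fun s a => abs_le_of_mem_Icc (hqV s a)]
  refine (abs_add_le _ _).trans (add_le_add le_rfl ?_)
  rw [abs_mul, abs_of_pos M.discount_pos]
  exact mul_le_mul_of_nonneg_left abs_integral_le_integral_abs M.discount_pos.le

/-- By `sub_qFun_eq` the residual is the evaluation error minus γ times its average at the next
step, hence at most (1 + γ) V. The bound R on the reward does not enter. -/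
lemma bellmanGap_le (M : MDP S A) (π : Kernel S A) [IsMarkovKernel π] {R : ℝ}
    (hR : ∀ s a, |M.reward s a| ≤ R) {Q : S → A → ℝ} (hQ : Measurable (Function.uncurry Q))
    {V : ℝ} (hV : ∀ s a, Q s a ∈ Set.Icc 0 V) (hqV : ∀ s a, qFun M π s a ∈ Set.Icc 0 V)
    (p : S × A) : bellmanGap M π Q p ≤ 2 * V := by
  have hΔ := fun p => (evalGap_mem_Icc hV hqV p).2
  have h1 := sub_qFun_eq M π hR hQ (fun s a => abs_le_of_mem_Icc (hV s a))
    (fun s a => abs_le_of_mem_Icc (hqV s a)) p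
  have h2 : |∫ q, (Q q.1 q.2 - qFun M π q.1 q.2) ∂stepKernel M π p| ≤ V :=
    abs_integral_le_of_abs_le hΔ
  have h3 := abs_le.1 h2
  have h4 := abs_le.1 (hΔ p)
  have hV0 : 0 ≤ V := (abs_nonneg _).trans h2
  have hγ := M.discount_pos
  have hγ' := M.discount_lt_one
  refine abs_le.2 ⟨?_, ?_⟩ <;> nlinarith

section Lipschitz

variable {A : Type*} [MeasurableSpace A] [PseudoMetricSpace A] [OpensMeasurableSpace A]

lemma lipschitzWith_evalGap {A : Type*} [MeasurableSpace A] [PseudoMetricSpace A]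
    {M : MDP S A} {π : Kernel S A} [IsMarkovKernel π] {Q : S → A → ℝ}
    {K : ℝ≥0} (hQ : ∀ s, LipschitzWith K (Q s)) (hq : ∀ s, LipschitzWith K (qFun M π s)) (s : S) :
    LipschitzWith (2 * K) fun a => evalGap M π Q (s, a) := by
  have h := LipschitzWith.comp (f := fun x : ℝ => |x|) (g := fun a => Q s a - qFun M π s a)
    (Kf := 1) (Kg := K + K) (lipschitzWith_one_norm (E := ℝ)) ((hQ s).sub (hq s))
  rw [one_mul, ← two_mul] at h
  exact h

lemma policyGap_le_wasserstein1 (hA : Bornology.IsBounded (Set.univ : Set A))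
    {κ η : Kernel S A} [IsMarkovKernel κ] [IsMarkovKernel η] {g : S × A → ℝ} {K : ℝ≥0}
    (hg : ∀ s, LipschitzWith K fun a => g (s, a)) {V : ℝ} (hV : ∀ p, |g p| ≤ V) (s : S) :
    policyGap κ η g s ≤ K * wasserstein1 (κ s) (η s) :=
  max_le (mul_nonneg K.2 (wasserstein1_nonneg _ _))
    (integral_sub_integral_le_wasserstein1 hA _ _ (hg s) fun a => hV (s, a))

lemma sub_le_mul_diam {A : Type*} [PseudoMetricSpace A]
    (hA : Bornology.IsBounded (Set.univ : Set A)) {g : A → ℝ} {K : ℝ≥0}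
    (hg : LipschitzWith K g) (a b : A) : g a - g b ≤ K * Metric.diam (Set.univ : Set A) := by
  refine (le_abs_self _).trans ((hg.dist_le_mul a b).trans ?_)
  exact mul_le_mul_of_nonneg_left
    (Metric.dist_le_diam_of_mem hA (Set.mem_univ _) (Set.mem_univ _)) K.2

lemma sub_integral_le_mul_diam (hA : Bornology.IsBounded (Set.univ : Set A)) {g : A → ℝ} {K : ℝ≥0}
    (hg : LipschitzWith K g) {V : ℝ} (hV : ∀ a, |g a| ≤ V) (μ : Measure A)
    [IsProbabilityMeasure μ] (a : A) :
    g a - ∫ b, g b ∂μ ≤ K * Metric.diam (Set.univ : Set A) := by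
  have hi : Integrable g μ := integrable_of_abs_le hg.continuous.measurable hV
  have := integral_mono (integrable_const (μ := μ) (g a - K * Metric.diam (Set.univ : Set A))) hi
    fun b => by linarith [sub_le_mul_diam hA hg a b]
  simp only [integral_const, probReal_univ, one_smul] at this
  linarith

lemma policyGap_le_mul_diam (hA : Bornology.IsBounded (Set.univ : Set A))
    {κ η : Kernel S A} [IsMarkovKernel κ] [IsMarkovKernel η] {g : S × A → ℝ} {K : ℝ≥0}
    (hg : ∀ s, LipschitzWith K fun a => g (s, a)) {V : ℝ} (hV : ∀ p, |g p| ≤ V) (s : S) :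
    policyGap κ η g s ≤ K * Metric.diam (Set.univ : Set A) := by
  refine max_le (mul_nonneg K.2 Metric.diam_nonneg) ?_
  have hi : Integrable (fun a => g (s, a)) (κ s) :=
    integrable_of_abs_le (hg s).continuous.measurable fun a => hV (s, a)
  have := integral_mono hi (integrable_const (μ := κ s)
    (∫ b, g (s, b) ∂η s + K * Metric.diam (Set.univ : Set A)))
    fun a => by linarith [sub_integral_le_mul_diam hA (hg s) (fun a => hV (s, a)) (η s) a]
  simp only [integral_const, probReal_univ, one_smul] at this
  linarith

end Lipschitz

instance (M : MDP S A) (ρ₀ : Measure S) [IsProbabilityMeasure ρ₀]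
    (π : Fin (n + 1) → Kernel S A) [∀ e, IsMarkovKernel (π e)] (w : Fin (n + 1) → ℝ) (i : ℕ) :
    IsFiniteMeasure (avgStateDist M ρ₀ π w i) := by
  refine ⟨?_⟩
  simp [avgStateDist, Measure.finsetSum_apply]

lemma integral_avgStateDist (M : MDP S A) (ρ₀ : Measure S) [IsProbabilityMeasure ρ₀]
    (π : Fin (n + 1) → Kernel S A) [∀ e, IsMarkovKernel (π e)] {w : Fin (n + 1) → ℝ}
    (hw : ∀ e, 0 < w e) (i : ℕ) {g : S → ℝ} (hg : Measurable g) {B : ℝ} (hB : ∀ s, |g s| ≤ B) :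
    ∫ s, g s ∂avgStateDist M ρ₀ π w i =
      ∑ e, w e / (∑ e', w e') * ∫ s, g s ∂stateDist M (π e) ρ₀ i := by
  rw [avgStateDist, integral_finsetSum_measure fun e _ =>
    (integrable_of_abs_le hg hB).smul_measure ENNReal.ofReal_ne_top]
  refine Finset.sum_congr rfl fun e _ => ?_
  rw [integral_smul_measure, ENNReal.toReal_ofReal
    (div_nonneg (hw e).le (Finset.sum_nonneg fun e _ => (hw e).le)), smul_eq_mul]

lemma sum_div_sum_eq_one {w : Fin (n + 1) → ℝ} (hw : ∀ e, 0 < w e) :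
    ∑ e, w e / (∑ e', w e') = 1 := by
  rw [← Finset.sum_div]
  exact div_self (Finset.sum_pos (fun e _ => hw e) Finset.univ_nonempty).ne'

/-- The integrand whose discounted averages control the evaluation error: Bellman residual plus
policy mismatch. -/
noncomputable def errorDensity (M : MDP S A) (ρ₀ : Measure S)
    (π : Fin (n + 1) → Kernel S A) [∀ e, IsMarkovKernel (π e)]
    (w : Fin (n + 1) → ℝ) (i : ℕ) (Q : S → A → ℝ) (p : S × A) : ℝ :=
  bellmanGap M (π (Fin.last n)) Q p + policyGap (π (Fin.last n)) (behaviorPolicy M ρ₀ π w i)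
    (evalGap M (π (Fin.last n)) Q) p.1

/-- The telescoping argument applied to episode-averaged means. Here K is a Lipschitz constant of
the gap itself, later taken to be 2 L_A. -/
lemma evalError_le {A : Type*} [MeasurableSpace A] [PseudoMetricSpace A] [OpensMeasurableSpace A]
    (hA : Bornology.IsBounded (Set.univ : Set A))
    (M : MDP S A) (ρ₀ : Measure S) [IsProbabilityMeasure ρ₀]
    (π : Fin (n + 1) → Kernel S A) [∀ e, IsMarkovKernel (π e)] {w : Fin (n + 1) → ℝ}
    (hw : ∀ e, 0 < w e) (i : ℕ) {R : ℝ} (hR : ∀ s a, |M.reward s a| ≤ R) {Q : S → A → ℝ}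
    (hQ : Measurable (Function.uncurry Q)) {V : ℝ} (hV : ∀ s a, Q s a ∈ Set.Icc 0 V)
    (hqV : ∀ s a, qFun M (π (Fin.last n)) s a ∈ Set.Icc 0 V) {K : ℝ≥0}
    (hK : ∀ s, LipschitzWith K fun a => evalGap M (π (Fin.last n)) Q (s, a)) (m : ℕ) :
    evalError M ρ₀ π w i Q ≤ ∑ k ∈ Finset.range m, M.discount ^ k * (∑ e, w e / (∑ e', w e') *
        ∫ p, errorDensity M ρ₀ π w i Q p ∂(stateDist M (π e) ρ₀ (i + k) ⊗ₘ π e)) +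
      M.discount ^ m * V +
      K * Metric.diam (Set.univ : Set A) * M.discount ^ m / (1 - M.discount) := by
  set W := ∑ e', w e' with hW
  have hWpos : 0 < W := Finset.sum_pos (fun e _ => hw e) Finset.univ_nonempty
  have hw' (e) : 0 ≤ w e / W := (div_pos (hw e) hWpos).le
  have hw1 : ∑ e, w e / W = 1 := sum_div_sum_eq_one hw
  set β := behaviorPolicy M ρ₀ π w i with hβ
  set G := evalGap M (π (Fin.last n)) Q with hG
  set f : S → ℝ := fun s => ∫ a, G (s, a) ∂β s with hf
  set h := policyGap (π (Fin.last n)) β G with hh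
  set b := bellmanGap M (π (Fin.last n)) Q with hb
  have hGm : Measurable G := measurable_evalGap M _ hR hQ
  have hGV (p) : G p ∈ Set.Icc 0 V := evalGap_mem_Icc hV hqV p
  have hGV' (p) : |G p| ≤ V := abs_le_of_mem_Icc (hGV p)
  have hfm : Measurable f := measurable_integral_kernel hGm
  have hfV (s) : f s ∈ Set.Icc 0 V :=
    integral_mem_Icc (hGm.comp measurable_prodMk_left) fun a => hGV (s, a)
  have hfV' (s) : |f s| ≤ V := abs_le_of_mem_Icc (hfV s)
  have hhm : Measurable h := measurable_policyGap hGm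
  have hfh (s) : f s + h s ≤ V := add_policyGap_le hGm hGV s
  have hh0 (s) : 0 ≤ h s := policyGap_nonneg _ _ _ _
  have hhV (s) : h s ∈ Set.Icc 0 V := ⟨hh0 s, by linarith [hfh s, (hfV s).1]⟩
  have hhV' (s) : |h s| ≤ V := abs_le_of_mem_Icc (hhV s)
  have hfhm : Measurable fun s => f s + h s := hfm.add hhm
  have hfhV (s) : |f s + h s| ≤ V :=
    abs_le_of_mem_Icc ⟨add_nonneg (hfV s).1 (hh0 s), hfh s⟩
  have hbm : Measurable b :=
    measurable_bellmanGap M _ hQ fun s a => abs_le_of_mem_Icc (hV s a)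
  have hbV' (p) : |b p| ≤ 2 * V :=
    abs_le_of_mem_Icc ⟨abs_nonneg _, bellmanGap_le M _ hR hQ hV hqV p⟩
  -- The states visited at step j + 1 come from the episode's own action at step j, while the
  -- Bellman operator draws the next action from the last policy. The gap h pays for changing that
  -- action to β.
  have hstep (e) (j : ℕ) : ∫ p, G p ∂(stateDist M (π e) ρ₀ j ⊗ₘ π e) ≤
      ∫ p, b p ∂(stateDist M (π e) ρ₀ j ⊗ₘ π e) + M.discount *
        (∫ s, f s ∂stateDist M (π e) ρ₀ (j + 1) + ∫ s, h s ∂stateDist M (π e) ρ₀ (j + 1)) := by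
    have hP : Integrable (fun p => ∫ s, (f s + h s) ∂M.transition p)
        (stateDist M (π e) ρ₀ j ⊗ₘ π e) :=
      integrable_of_abs_le hfhm.stronglyMeasurable.integral_kernel.measurable
        fun p => abs_integral_le_of_abs_le hfhV
    rw [← integral_add (integrable_of_abs_le hfm hfV') (integrable_of_abs_le hhm hhV'),
      integral_stateDist_succ M (π e) ρ₀ j hfhm hfhV, ← integral_const_mul,
      ← integral_add (integrable_of_abs_le hbm hbV') (hP.const_mul _)]
    refine integral_mono (integrable_of_abs_le hGm hGV')
      ((integrable_of_abs_le hbm hbV').add (hP.const_mul _)) fun p => ?_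
    refine (evalGap_le M _ hR hQ hV hqV p).trans (add_le_add le_rfl
      (mul_le_mul_of_nonneg_left ?_ M.discount_pos.le))
    exact integral_mono (integrable_of_abs_le (measurable_integral_kernel hGm) fun s =>
      abs_integral_le_of_abs_le fun a => hGV' (s, a)) (integrable_of_abs_le hfhm hfhV)
        fun s => le_add_policyGap _ _ _ _
  have hconst (e) (μ : Measure S) [IsProbabilityMeasure μ] {g : S → ℝ} (hg : Measurable g)
      (hgV : ∀ s, |g s| ≤ V) : ∫ p, g p.1 ∂(μ ⊗ₘ π e) = ∫ s, g s ∂μ := by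
    rw [Measure.integral_compProd (f := fun p : S × A => g p.1)
      (integrable_of_abs_le (hg.comp measurable_fst) fun p => hgV p.1)]
    simp
  -- At a fixed state, G differs from its mean under any policy by at most its oscillation in the
  -- action.
  have hdiff (e) (j : ℕ) : -(K * Metric.diam (Set.univ : Set A)) ≤
      ∫ s, f s ∂stateDist M (π e) ρ₀ j - ∫ p, G p ∂(stateDist M (π e) ρ₀ j ⊗ₘ π e) := by
    have h1 := integral_mono (μ := stateDist M (π e) ρ₀ j ⊗ₘ π e)
      (integrable_of_abs_le hGm hGV')
      ((integrable_of_abs_le (g := fun p : S × A => f p.1) (hfm.comp measurable_fst)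
        fun p => hfV' p.1).add
        (integrable_const (K * Metric.diam (Set.univ : Set A)))) fun p => by
        have := sub_integral_le_mul_diam hA (hK p.1) (fun a => hGV' (p.1, a)) (β p.1) p.2
        change G p ≤ f p.1 + _
        change G p - f p.1 ≤ _ at this
        linarith
    simp only [Pi.add_apply] at h1
    rw [integral_add (integrable_of_abs_le (g := fun p : S × A => f p.1)
      (hfm.comp measurable_fst) fun p => hfV' p.1) (integrable_const _), hconst e _ hfm hfV'] at h1
    simp only [integral_const, probReal_univ, one_smul] at h1
    linarith
  have hval (e) (j : ℕ) :
      ∫ s, f s ∂stateDist M (π e) ρ₀ j + ∫ s, h s ∂stateDist M (π e) ρ₀ j ≤ V := by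
    rw [← integral_add (integrable_of_abs_le hfm hfV') (integrable_of_abs_le hhm hhV')]
    exact (integral_mem_Icc (hfm.add hhm)
      fun s => ⟨add_nonneg (hfV s).1 (hh0 s), hfh s⟩ : _ ∈ Set.Icc 0 V).2
  have hsum := (hasSum_behaviorPolicy_sub M ρ₀ π (fun e => (hw e).le) i hGm hGV').mul_left W⁻¹
  rw [mul_zero] at hsum
  have key := telescoping_bound (γ := M.discount) (V := V)
    (K := K * Metric.diam (Set.univ : Set A)) M.discount_pos.le M.discount_lt_one
    (a := fun k => ∑ e, w e / W * ∫ s, f s ∂stateDist M (π e) ρ₀ (i + k))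
    (b := fun k => ∑ e, w e / W * ∫ p, G p ∂(stateDist M (π e) ρ₀ (i + k) ⊗ₘ π e))
    (c := fun k => ∑ e, w e / W * ∫ p, b p ∂(stateDist M (π e) ρ₀ (i + k) ⊗ₘ π e))
    (d := fun k => ∑ e, w e / W * ∫ s, h s ∂stateDist M (π e) ρ₀ (i + k))
    ?_ ?_ ?_ ?_ ?_ m
  · have hev : evalError M ρ₀ π w i Q =
        ∑ e, w e / W * ∫ s, f s ∂stateDist M (π e) ρ₀ (i + 0) := by
      rw [add_zero, ← integral_avgStateDist M ρ₀ π hw i hfm hfV']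
      exact Measure.integral_compProd (integrable_of_abs_le hGm hGV')
    rw [hev]
    refine key.trans_eq ?_
    congr 2
    refine Finset.sum_congr rfl fun k _ => ?_
    rw [← Finset.sum_add_distrib]
    congr 1
    refine Finset.sum_congr rfl fun e _ => ?_
    rw [← mul_add, ← hconst e _ hhm hhV', ← integral_add (integrable_of_abs_le hbm hbV')
      (integrable_of_abs_le (g := fun p : S × A => h p.1) (hhm.comp measurable_fst)
        fun p => hhV' p.1)]
    rfl
  · refine (congrArg (HasSum · 0) (funext fun k => ?_)).mpr hsum
    rw [← Finset.sum_sub_distrib, mul_left_comm]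
    congr 1
    rw [Finset.mul_sum]
    refine Finset.sum_congr rfl fun e _ => ?_
    rw [div_eq_mul_inv]
    ring
  · intro k
    rw [← Finset.sum_sub_distrib]
    calc -(K * Metric.diam (Set.univ : Set A))
        = ∑ e, w e / W * -(K * Metric.diam (Set.univ : Set A)) := by
          rw [← Finset.sum_mul, hw1, one_mul]
      _ ≤ _ := Finset.sum_le_sum fun e _ => by
          rw [← mul_sub]
          exact mul_le_mul_of_nonneg_left (hdiff e _) (hw' e)
  · intro k
    rw [← Finset.sum_add_distrib, Finset.mul_sum, ← Finset.sum_add_distrib]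
    refine Finset.sum_le_sum fun e _ => ?_
    have := mul_le_mul_of_nonneg_left (hstep e (i + k)) (hw' e)
    rw [add_assoc] at this
    linarith
  · exact Finset.sum_nonneg fun e _ => mul_nonneg (hw' e) (integral_nonneg hh0)
  · intro k
    rw [← Finset.sum_add_distrib]
    calc _ ≤ ∑ e, w e / W * V := Finset.sum_le_sum fun e _ => by
          rw [← mul_add]
          exact mul_le_mul_of_nonneg_left (hval e _) (hw' e)
      _ = V := by rw [← Finset.sum_mul, hw1, one_mul]

end Evaluation

/-! ### Concentration of replay means and assembly of the two bounds. -/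

section Replay

variable {S A : Type*} [MeasurableSpace S] [MeasurableSpace A] {n : ℕ}

lemma sum_filter_le_fin {i L : ℕ} (g : ℕ → ℝ) :
    ∑ j ∈ Finset.univ.filter (fun j : Fin L => i ≤ (j : ℕ)), g j =
      ∑ k ∈ Finset.range (L - i), g (i + k) := by
  rw [Finset.sum_filter, Fin.sum_univ_eq_sum_range (fun j => if i ≤ j then g j else 0),
    ← Finset.sum_filter, ← Finset.sum_Ico_eq_sum_range]
  congr 1
  ext j
  simp [and_comm]

lemma replayMean_le_add {S A : Type*} {L : ℕ} {γ : ℝ} (hγ₀ : 0 ≤ γ) (hγ₁ : γ ≤ 1)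
    {w : Fin (n + 1) → ℝ} (hw : ∀ e, 0 ≤ w e) (i : ℕ) (x : Fin (n + 1) → Fin L → S × A) {F f g : S → A → ℝ} {K : ℝ}
    (h : ∀ s a, F s a ≤ f s a + K * g s a) :
    replayMean γ w i x F ≤ replayMean γ w i x f + K * replayMean γ w i x g := by
  unfold replayMean
  rw [mul_left_comm, ← mul_add]
  refine mul_le_mul_of_nonneg_left ?_ (inv_nonneg.2 (Finset.sum_nonneg fun e _ => hw e))
  rw [Finset.mul_sum, ← Finset.sum_add_distrib]
  refine Finset.sum_le_sum fun e _ => ?_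
  rw [Finset.mul_sum, ← Finset.sum_add_distrib]
  refine Finset.sum_le_sum fun j _ => ?_
  have := mul_le_mul_of_nonneg_left (h (x e j).1 (x e j).2)
    (mul_nonneg (mul_nonneg (sub_nonneg.2 hγ₁) (pow_nonneg hγ₀ ((j : ℕ) - i))) (hw e))
  linarith

lemma replayMean_nonneg {S A : Type*} {L : ℕ} {γ : ℝ} (hγ₀ : 0 ≤ γ) (hγ₁ : γ ≤ 1)
    {w : Fin (n + 1) → ℝ} (hw : ∀ e, 0 ≤ w e) (i : ℕ) (x : Fin (n + 1) → Fin L → S × A) {f : S → A → ℝ}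
    (h : ∀ s a, 0 ≤ f s a) : 0 ≤ replayMean γ w i x f :=
  mul_nonneg (inv_nonneg.2 (Finset.sum_nonneg fun e _ => hw e)) <|
    Finset.sum_nonneg fun e _ => Finset.sum_nonneg fun _ _ =>
      mul_nonneg (mul_nonneg (mul_nonneg (sub_nonneg.2 hγ₁) (pow_nonneg hγ₀ _)) (hw e)) (h _ _)

lemma integral_sampleLaw (M : MDP S A) (π : Kernel S A) [IsMarkovKernel π] (ρ₀ : Measure S)
    [IsProbabilityMeasure ρ₀] {L : ℕ} (j : Fin L) {F : S × A → ℝ} (hF : Measurable F) :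
    ∫ y, F (y j) ∂sampleLaw M π ρ₀ L = ∫ p, F p ∂(stateDist M π ρ₀ j ⊗ₘ π) := by
  rw [sampleLaw, integral_map
    (φ := fun (x : ℕ → S × A) (j : Fin L) => x j) (f := fun y => F (y j))
    (Measurable.aemeasurable <| measurable_pi_lambda _ fun j => measurable_pi_apply (j : ℕ))
    (hF.comp (measurable_pi_apply j)).aestronglyMeasurable, ← policyLaw_map,
    integral_map (measurable_pi_apply _).aemeasurable hF.aestronglyMeasurable]

/-- Concentration of the replay mean of a bounded function around its expectation. -/
lemma exists_event_replayMean {Ω : Type*} [MeasurableSpace Ω] {P : Measure Ω}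
    [IsProbabilityMeasure P] (M : MDP S A) (ρ₀ : Measure S) [IsProbabilityMeasure ρ₀]
    (π : Fin (n + 1) → Kernel S A) [∀ e, IsMarkovKernel (π e)] {w : Fin (n + 1) → ℝ}
    (hw : ∀ e, 0 < w e) (L i : ℕ) {X : Fin (n + 1) → Ω → Fin L → S × A} (hind : iIndepFun X P)
    (hlaw : ∀ e, HasLaw (X e) (sampleLaw M (π e) ρ₀ L) P) {F : S × A → ℝ} (hF : Measurable F)
    {B : ℝ} (hB : ∀ p, F p ∈ Set.Icc 0 B) {δ : ℝ} (hδ₀ : 0 < δ) (hδ₁ : δ < 1) :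
    ∃ E : Set Ω, MeasurableSet E ∧ 1 - δ < P.real E ∧ ∀ ω ∈ E,
      (1 - M.discount) * ∑ k ∈ Finset.range (L - i), M.discount ^ k *
          (∑ e, w e / (∑ e', w e') * ∫ p, F p ∂(stateDist M (π e) ρ₀ (i + k) ⊗ₘ π e)) ≤
        replayMean M.discount w i (fun e => X e ω) (fun s a => F (s, a)) +
          √((∑ e, (w e / (∑ e', w e') * B) ^ 2) / 2 * Real.log (2 / δ)) := by
  set γ := M.discount with hγ
  have hγ₀ : 0 < γ := M.discount_pos
  have hγ₁ : 0 < 1 - γ := sub_pos.2 M.discount_lt_one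
  set W := ∑ e', w e' with hW
  have hWpos : 0 < W := Finset.sum_pos (fun e _ => hw e) Finset.univ_nonempty
  have hw' (e) : 0 ≤ w e / W := (div_pos (hw e) hWpos).le
  -- Samples within a trajectory are dependent, so Hoeffding is applied with one variable per
  -- episode. The discount weights of an episode sum to 1 - γ^{L-i} ≤ 1, which gives the range w_e B
  -- / W.
  set φ : Fin (n + 1) → (Fin L → S × A) → ℝ := fun e y =>
    ∑ j ∈ Finset.univ.filter (fun j : Fin L => i ≤ (j : ℕ)),
      (1 - γ) * γ ^ ((j : ℕ) - i) * (w e / W) * F (y j) with hφ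
  have hc (e) (j : Fin L) : 0 ≤ (1 - γ) * γ ^ ((j : ℕ) - i) * (w e / W) :=
    mul_nonneg (mul_nonneg hγ₁.le (pow_nonneg hγ₀.le _)) (hw' e)
  have hφm (e) : Measurable (φ e) := Finset.measurable_sum _ fun j _ =>
    (hF.comp (measurable_pi_apply j)).const_mul _
  have hB0 (p : S × A) : 0 ≤ B := (hB p).1.trans (hB p).2
  have hφB (e) (y) : φ e y ∈ Set.Icc 0 (w e / W * B) := by
    refine ⟨Finset.sum_nonneg fun j _ => mul_nonneg (hc e j) (hB _).1, ?_⟩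
    have hBnn : 0 ≤ B := by
      obtain ⟨s⟩ := nonempty_of_isProbabilityMeasure ρ₀
      obtain ⟨a⟩ := nonempty_of_isProbabilityMeasure (π 0 s)
      exact hB0 (s, a)
    calc φ e y ≤ ∑ j ∈ Finset.univ.filter (fun j : Fin L => i ≤ (j : ℕ)),
          (1 - γ) * γ ^ ((j : ℕ) - i) * (w e / W) * B :=
          Finset.sum_le_sum fun j _ => mul_le_mul_of_nonneg_left (hB _).2 (hc e j)
      _ = (∑ k ∈ Finset.range (L - i), γ ^ k) * (1 - γ) * (w e / W * B) := by
          rw [sum_filter_le_fin fun j => (1 - γ) * γ ^ (j - i) * (w e / W) * B,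
            Finset.sum_mul, Finset.sum_mul]
          refine Finset.sum_congr rfl fun k _ => ?_
          rw [Nat.add_sub_cancel_left]
          ring
      _ ≤ 1 * (w e / W * B) := by
          refine mul_le_mul_of_nonneg_right ?_ (mul_nonneg (hw' e) hBnn)
          rw [geom_sum_mul_neg]
          linarith [pow_nonneg hγ₀.le (L - i)]
      _ = w e / W * B := one_mul _
  obtain ⟨E, hE, hPE, hEb⟩ := exists_event_sum_integral_le (P := P)
    (Z := fun e => φ e ∘ X e) (hind.comp φ hφm)
    (fun e => (hφm e).comp_aemeasurable (hlaw e).aemeasurable) (b := fun e => w e / W * B)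
    (fun e ω => hφB e _) hδ₀ hδ₁
  refine ⟨E, hE, hPE, fun ω hω => ?_⟩
  have hint (e) : ∫ ω, (φ e ∘ X e) ω ∂P = ∑ k ∈ Finset.range (L - i), (1 - γ) * (γ ^ k *
      (w e / W * ∫ p, F p ∂(stateDist M (π e) ρ₀ (i + k) ⊗ₘ π e))) := by
    have hp : IsProbabilityMeasure (sampleLaw M (π e) ρ₀ L) := (hlaw e).map_eq ▸
      Measure.isProbabilityMeasure_map (hlaw e).aemeasurable
    have h1 : ∫ ω, (φ e ∘ X e) ω ∂P = ∫ y, φ e y ∂sampleLaw M (π e) ρ₀ L := by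
      rw [← (hlaw e).map_eq, integral_map (hlaw e).aemeasurable (hφm e).aestronglyMeasurable]
      rfl
    rw [h1, hφ, integral_finsetSum _ fun j _ => Integrable.const_mul (integrable_of_abs_le
      (g := fun y : Fin L → S × A => F (y j)) (hF.comp (measurable_pi_apply j))
        fun y => abs_le_of_mem_Icc (hB _)) _]
    simp only [integral_const_mul, integral_sampleLaw M (π e) ρ₀ _ hF]
    rw [sum_filter_le_fin fun j => (1 - γ) * γ ^ (j - i) * (w e / W) *
      ∫ p, F p ∂(stateDist M (π e) ρ₀ j ⊗ₘ π e)]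
    refine Finset.sum_congr rfl fun k _ => ?_
    rw [Nat.add_sub_cancel_left]
    ring
  have hmean : replayMean γ w i (fun e => X e ω) (fun s a => F (s, a)) =
      ∑ e, (φ e ∘ X e) ω := by
    rw [replayMean, Finset.mul_sum]
    refine Finset.sum_congr rfl fun e _ => ?_
    rw [Finset.mul_sum]
    refine Finset.sum_congr rfl fun j _ => ?_
    rw [div_eq_mul_inv]
    ring
  rw [hmean]
  refine (hEb ω hω).trans_eq' ?_
  simp only [hint]
  rw [Finset.sum_comm, Finset.mul_sum]
  refine Finset.sum_congr rfl fun k _ => ?_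
  rw [Finset.mul_sum, Finset.mul_sum]

/-- The normalized form of the evaluation bound follows from the explicit one. -/
lemma normalized_bound {x D r d c LA σ ℓ u ε ξ W e : ℝ} (hD₀ : 0 < D) (hD₁ : D < 1) (hr : 0 ≤ r)
    (hd : 0 ≤ d) (hc : 0 ≤ c) (hLA : LA = c / D) (hσ : 0 ≤ σ) (hℓ : 1 / 4 ≤ ℓ)
    (hu : u ≤ ε) (hε : 0 ≤ ε) (hξ : 0 ≤ ξ) (he : e = ξ / D) (hW : 0 ≤ W)
    (hx : x ≤ r / D * (σ * √(ℓ / 2)) + (r / D ^ 2 + 2 * LA * d / D) * (σ * √(2 * ℓ) + u) +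
      1 / D * (e + 2 * LA * W)) :
    x ≤ 10 * √ℓ * (1 / D ^ 2 * ((r + c * d) * (σ + ε) + ξ + c * W)) := by
  -- This is what lets terms carrying no logarithm be absorbed: 1 ≤ 2√ℓ.
  have hl : 1 / 2 ≤ √ℓ := Real.le_sqrt_of_sq_le (by linarith)
  have h1 : √(ℓ / 2) ≤ √ℓ := Real.sqrt_le_sqrt (by linarith)
  have h2 : √(2 * ℓ) ≤ 2 * √ℓ := by
    rw [Real.sqrt_mul (by norm_num)]
    exact mul_le_mul_of_nonneg_right (Real.sqrt_le_iff.2 (by norm_num))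
      (Real.sqrt_nonneg _)
  set t := √ℓ
  have hD2 : r / D ≤ r / D ^ 2 :=
    div_le_div_of_nonneg_left hr (by positivity) (by nlinarith)
  have h3 : r / D * (σ * √(ℓ / 2)) ≤ r / D ^ 2 * (σ * t) :=
    mul_le_mul hD2 (mul_le_mul_of_nonneg_left h1 hσ) (by positivity) (by positivity)
  have h4 : (r / D ^ 2 + 2 * LA * d / D) * (σ * √(2 * ℓ) + u) ≤
      (2 * (r + c * d) / D ^ 2) * (2 * t * (σ + ε)) := by
    have h5 : r / D ^ 2 + 2 * LA * d / D ≤ 2 * (r + c * d) / D ^ 2 := by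
      rw [hLA, show r / D ^ 2 + 2 * (c / D) * d / D = (r + 2 * (c * d)) / D ^ 2 by field_simp]
      exact div_le_div_of_nonneg_right (by linarith) (by positivity)
    have h6 : σ * √(2 * ℓ) + u ≤ 2 * t * (σ + ε) := by
      nlinarith [mul_le_mul_of_nonneg_left h2 hσ, mul_le_mul_of_nonneg_right hl hε]
    have h7 : 0 ≤ 2 * (r + c * d) / D ^ 2 := by positivity
    have h8 : 0 ≤ r / D ^ 2 + 2 * LA * d / D := by rw [hLA]; positivity
    exact (mul_le_mul_of_nonneg_left h6 h8).trans (mul_le_mul_of_nonneg_right h5 (by positivity))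
  have h9 : 1 / D * (e + 2 * LA * W) = (ξ + 2 * (c * W)) / D ^ 2 := by
    rw [he, hLA]; field_simp
  have h10 : (ξ + 2 * (c * W)) ≤ 4 * t * (ξ + c * W) := by
    nlinarith [mul_nonneg hc hW]
  have h11 := div_le_div_of_nonneg_right h10 (sq_nonneg D)
  have h12 : 0 ≤ t * (c * d * (σ + ε) + r * ε) / D ^ 2 := by positivity
  have h13 : 0 ≤ t * (ξ + c * W) / D ^ 2 := by positivity
  have h14 : 0 ≤ t * (r * σ) / D ^ 2 := by positivity
  -- The estimates use coefficient 5 on rσ and 4 on everything else; the remaining nonnegative terms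
  -- show that 10 is more than enough.
  have h15 : 10 * t * (1 / D ^ 2 * ((r + c * d) * (σ + ε) + ξ + c * W)) =
      r / D ^ 2 * (σ * t) + (2 * (r + c * d) / D ^ 2) * (2 * t * (σ + ε)) +
        4 * t * (ξ + c * W) / D ^ 2 + 6 * (t * (c * d * (σ + ε) + r * ε) / D ^ 2) +
        6 * (t * (ξ + c * W) / D ^ 2) + 5 * (t * (r * σ) / D ^ 2) := by
    field_simp
    ring
  rw [h15]
  linarith

/-- The explicit form of the evaluation bound. -/
lemma exists_event_evalError_le {Ω : Type*} [PseudoMetricSpace A] [OpensMeasurableSpace A]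
    [MeasurableSpace Ω] {P : Measure Ω} [IsProbabilityMeasure P]
    (hA : Bornology.IsBounded (Set.univ : Set A)) (M : MDP S A) (ρ₀ : Measure S)
    [IsProbabilityMeasure ρ₀] (π : Fin (n + 1) → Kernel S A) [∀ e, IsMarkovKernel (π e)]
    {w : Fin (n + 1) → ℝ} (hw : ∀ e, 0 < w e) (L i : ℕ)
    {X : Fin (n + 1) → Ω → Fin L → S × A} (hind : iIndepFun X P)
    (hlaw : ∀ e, HasLaw (X e) (sampleLaw M (π e) ρ₀ L) P) {R : ℝ}
    (hR : ∀ s a, |M.reward s a| ≤ R) {Q : S → A → ℝ} (hQ : Measurable (Function.uncurry Q))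
    {V : ℝ} (hV : ∀ s a, Q s a ∈ Set.Icc 0 V)
    (hqV : ∀ s a, qFun M (π (Fin.last n)) s a ∈ Set.Icc 0 V) {K : ℝ≥0}
    (hQK : ∀ s, LipschitzWith K (Q s)) (hqK : ∀ s, LipschitzWith K (qFun M (π (Fin.last n)) s))
    {δ : ℝ} (hδ₀ : 0 < δ) (hδ₁ : δ < 1) :
    ∃ E : Set Ω, MeasurableSet E ∧ 1 - δ < P.real E ∧ ∀ ω ∈ E,
      evalError M ρ₀ π w i Q ≤
        (V / (1 - M.discount) + 2 * K * Metric.diam (Set.univ : Set A) / (1 - M.discount)) *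
          (√(2 * (∑ e, w e ^ 2) / (∑ e, w e) ^ 2 * Real.log (2 / δ)) + M.discount ^ (L - i)) +
        1 / (1 - M.discount) * (bellmanError M π w i (fun e => X e ω) Q +
          2 * K * policyMismatch M ρ₀ π w i (fun e => X e ω)) := by
  have hD : 0 < 1 - M.discount := sub_pos.2 M.discount_lt_one
  set d := Metric.diam (Set.univ : Set A) with hd
  have hd0 : 0 ≤ d := Metric.diam_nonneg
  have hlip := lipschitzWith_evalGap hQK hqK
  have hVabs := fun s a => abs_le_of_mem_Icc (hV s a)
  have hGm := measurable_evalGap M (π (Fin.last n)) hR hQ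
  have hGV := fun p => abs_le_of_mem_Icc (evalGap_mem_Icc hV hqV p)
  have hFm : Measurable (errorDensity M ρ₀ π w i Q) :=
    (measurable_bellmanGap M _ hQ hVabs).add ((measurable_policyGap hGm).comp measurable_fst)
  have hFB (p) : errorDensity M ρ₀ π w i Q p ∈ Set.Icc 0 (2 * V + 2 * K * d) := by
    have h1 := bellmanGap_le M _ hR hQ hV hqV p
    have h2 := policyGap_le_mul_diam (κ := π (Fin.last n)) (η := behaviorPolicy M ρ₀ π w i)
      hA hlip hGV p.1
    push_cast at h2
    exact ⟨add_nonneg (abs_nonneg _) (policyGap_nonneg _ _ _ _), add_le_add h1 h2⟩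
  obtain ⟨E, hE, hPE, hb⟩ := exists_event_replayMean M ρ₀ π hw L i hind hlaw hFm hFB hδ₀ hδ₁
  refine ⟨E, hE, hPE, fun ω hω => ?_⟩
  have h1 := hb ω hω
  have h2 := evalError_le hA M ρ₀ π hw i hR hQ hV hqV hlip (L - i)
  have h3 : replayMean M.discount w i (fun e => X e ω)
      (fun s a => errorDensity M ρ₀ π w i Q (s, a)) ≤
      bellmanError M π w i (fun e => X e ω) Q +
        2 * K * policyMismatch M ρ₀ π w i (fun e => X e ω) := by
    refine replayMean_le_add M.discount_pos.le M.discount_lt_one.le (fun e => (hw e).le) i _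
      fun s a => add_le_add le_rfl ?_
    have := policyGap_le_wasserstein1 (κ := π (Fin.last n)) (η := behaviorPolicy M ρ₀ π w i)
      hA hlip hGV s
    push_cast at this
    exact this
  have hV0 : 0 ≤ V := by
    obtain ⟨s⟩ := nonempty_of_isProbabilityMeasure ρ₀
    obtain ⟨a⟩ := nonempty_of_isProbabilityMeasure (π 0 s)
    exact (hV s a).1.trans (hV s a).2
  set T := √(2 * (∑ e, w e ^ 2) / (∑ e, w e) ^ 2 * Real.log (2 / δ)) with hT
  -- The range of the error density is 2(V + K diam), so its square over 2 is 2 (V + K diam)².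
  have hsq : √((∑ e, (w e / (∑ e', w e') * (2 * V + 2 * K * d)) ^ 2) / 2 * Real.log (2 / δ)) =
      (V + K * d) * T := by
    have h4 : 0 ≤ V + K * d := by positivity
    rw [hT, ← Real.sqrt_sq h4, ← Real.sqrt_mul (sq_nonneg _)]
    congr 1
    simp only [mul_pow, div_pow]
    rw [← Finset.sum_mul, ← Finset.sum_div]
    ring
  rw [hsq] at h1
  set D₀ := ∑ k ∈ Finset.range (L - i), M.discount ^ k * (∑ e, w e / (∑ e', w e') *
        ∫ p, errorDensity M ρ₀ π w i Q p ∂(stateDist M (π e) ρ₀ (i + k) ⊗ₘ π e))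
  set u := M.discount ^ (L - i)
  have hu : 0 ≤ u := pow_nonneg M.discount_pos.le _
  have hT0 : 0 ≤ T := Real.sqrt_nonneg _
  have hKd : 0 ≤ K * d := by positivity
  push_cast at h2
  have h5 : D₀ ≤ 1 / (1 - M.discount) * (bellmanError M π w i (fun e => X e ω) Q +
      2 * K * policyMismatch M ρ₀ π w i (fun e => X e ω) + (V + K * d) * T) := by
    rw [one_div, ← div_eq_inv_mul, le_div_iff₀ hD]
    linarith
  have h6 : u * V ≤ V / (1 - M.discount) * u := by
    rw [mul_comm]
    refine mul_le_mul_of_nonneg_right ?_ hu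
    rw [le_div_iff₀ hD]
    nlinarith [M.discount_pos]
  -- Hoeffding produces K diam T/(1 - γ) once, whereas the stated coefficient has it twice; this is
  -- the slack.
  have h7 : 0 ≤ K * d * T / (1 - M.discount) := by positivity
  calc evalError M ρ₀ π w i Q
      ≤ D₀ + u * V + 2 * K * d * u / (1 - M.discount) := h2
    _ ≤ 1 / (1 - M.discount) * (bellmanError M π w i (fun e => X e ω) Q +
          2 * K * policyMismatch M ρ₀ π w i (fun e => X e ω) + (V + K * d) * T) +
          V / (1 - M.discount) * u + 2 * K * d * u / (1 - M.discount) +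
          K * d * T / (1 - M.discount) := by linarith
    _ = _ := by ring

end Replay

end OffPolicy

/-! ### The two bounds. -/

theorem corollary2 :
    -- the absolute constant of the second bound
    ∃ C : ℝ, 0 < C ∧
    ∀ {S A Ω : Type*} [MeasurableSpace S]
      [MetricSpace A] [SecondCountableTopology A] [MeasurableSpace A] [BorelSpace A]
      [MeasurableSpace Ω] (P : Measure Ω) [IsProbabilityMeasure P]
      (M : OffPolicy.MDP S A) (ρ₀ : Measure S) [IsProbabilityMeasure ρ₀]
      -- `N = n + 1` episodes, their policies, and their weights
      (n : ℕ) (π : Fin (n + 1) → Kernel S A) [∀ e, IsMarkovKernel (π e)]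
      (w : Fin (n + 1) → ℝ) (_hw : ∀ e, 0 < w e)
      -- trajectory length and trajectory step
      (L i : ℕ) (_hi : i ≤ L)
      -- the replay buffer: independent length-`L` trajectories, the `e`-th one following `π e`
      (X : Fin (n + 1) → Ω → Fin L → S × A)
      (_hindep : iIndepFun X P)
      (_hlaw : ∀ e, HasLaw (X e) (OffPolicy.sampleLaw M (π e) ρ₀ L) P)
      -- bounded rewards
      (_hr : ∃ R : ℝ, ∀ s a, |M.reward s a| ≤ R)
      (Qhat : S → A → ℝ) (_hQmeas : Measurable (Function.uncurry Qhat))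
      -- (1) both Q functions are Lipschitz in the action
      (LA : ℝ≥0) (_hQlip : ∀ s, LipschitzWith LA (Qhat s))
      (_hQπlip : ∀ s, LipschitzWith LA (OffPolicy.qFun M (π (Fin.last n)) s))
      -- (2) both Q functions take values in `[0, rmax / (1 - γ)]`
      (rmax : ℝ) (_hQbdd : ∀ s a, Qhat s a ∈ Set.Icc 0 (rmax / (1 - M.discount)))
      (_hQπbdd : ∀ s a,
        OffPolicy.qFun M (π (Fin.last n)) s a ∈ Set.Icc 0 (rmax / (1 - M.discount)))
      -- (3) the action space is bounded
      (_hA : Bornology.IsBounded (Set.univ : Set A))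
      (δ : ℝ) (_hδ₀ : 0 < δ) (_hδ₁ : δ < 1),
      -- first bound
      (∃ E : Set Ω, MeasurableSet E ∧ 1 - δ < P.real E ∧ ∀ ω ∈ E,
        OffPolicy.evalError M ρ₀ π w i Qhat ≤
          rmax / (1 - M.discount) *
              √((∑ e, w e ^ 2) / (2 * (∑ e, w e) ^ 2) * Real.log (2 / δ))
          + (rmax / (1 - M.discount) ^ 2
                + 2 * LA * Metric.diam (Set.univ : Set A) / (1 - M.discount))
              * (√(2 * (∑ e, w e ^ 2) / (∑ e, w e) ^ 2 * Real.log (2 / δ))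
                  + M.discount ^ (L - i))
          + 1 / (1 - M.discount) *
              (OffPolicy.bellmanError M π w i (fun e => X e ω) Qhat
                + 2 * LA * OffPolicy.policyMismatch M ρ₀ π w i (fun e => X e ω))) ∧
      -- second bound, with normalized constants
      (∀ (ε : ℝ) (_hε₀ : 0 < ε) (_hε₁ : ε < 1)
        (_hiε : (i : ℝ) ≤ L - Real.log ε / Real.log M.discount)
        (c : ℝ) (_hc : (LA : ℝ) = c / (1 - M.discount))
        (ξ : Ω → ℝ) (_hξ : ∀ ω, OffPolicy.bellmanError M π w i (fun e => X e ω) Qhat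
          = ξ ω / (1 - M.discount)),
        ∃ E : Set Ω, MeasurableSet E ∧ 1 - δ < P.real E ∧ ∀ ω ∈ E,
          OffPolicy.evalError M ρ₀ π w i Qhat ≤
            C * √(Real.log (2 / δ)) * (1 / (1 - M.discount) ^ 2 *
              ((rmax + c * Metric.diam (Set.univ : Set A))
                  * (√(∑ e, w e ^ 2) / (∑ e, w e) + ε)
                + ξ ω + c * OffPolicy.policyMismatch M ρ₀ π w i (fun e => X e ω)))) := by
  refine ⟨10, by norm_num, ?_⟩
  intro S A Ω _ _ _ _ _ _ P _ M ρ₀ _ n π _ w hw L i hi X hindep hlaw hr Qhat hQmeas LA hQlip hQπlip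
    rmax hQbdd hQπbdd hA δ hδ₀ hδ₁
  obtain ⟨R, hR⟩ := hr
  obtain ⟨E, hE, hPE, hb⟩ := OffPolicy.exists_event_evalError_le hA M ρ₀ π hw L i hindep hlaw hR
    hQmeas hQbdd hQπbdd hQlip hQπlip hδ₀ hδ₁
  have hD : 0 < 1 - M.discount := sub_pos.2 M.discount_lt_one
  have hD1 : 1 - M.discount < 1 := sub_lt_self _ M.discount_pos
  have hV : 0 ≤ rmax / (1 - M.discount) := by
    obtain ⟨s⟩ := nonempty_of_isProbabilityMeasure ρ₀
    obtain ⟨a⟩ := nonempty_of_isProbabilityMeasure (π 0 s)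
    exact (hQbdd s a).1.trans (hQbdd s a).2
  have hrmax : 0 ≤ rmax := by
    have := mul_nonneg hV hD.le
    rwa [div_mul_cancel₀ _ hD.ne'] at this
  have hW : 0 < ∑ e, w e := Finset.sum_pos (fun e _ => hw e) Finset.univ_nonempty
  have hfirst : ∀ ω ∈ E, OffPolicy.evalError M ρ₀ π w i Qhat ≤
      rmax / (1 - M.discount) *
          √((∑ e, w e ^ 2) / (2 * (∑ e, w e) ^ 2) * Real.log (2 / δ))
      + (rmax / (1 - M.discount) ^ 2
            + 2 * LA * Metric.diam (Set.univ : Set A) / (1 - M.discount))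
          * (√(2 * (∑ e, w e ^ 2) / (∑ e, w e) ^ 2 * Real.log (2 / δ))
              + M.discount ^ (L - i))
      + 1 / (1 - M.discount) *
          (OffPolicy.bellmanError M π w i (fun e => X e ω) Qhat
            + 2 * LA * OffPolicy.policyMismatch M ρ₀ π w i (fun e => X e ω)) := by
    intro ω hω
    have h1 := hb ω hω
    rw [div_div, ← pow_two] at h1
    -- The first square-root term is nonnegative and is simply added to a bound that holds without
    -- it.
    have h2 := mul_nonneg hV
      (Real.sqrt_nonneg ((∑ e, w e ^ 2) / (2 * (∑ e, w e) ^ 2) * Real.log (2 / δ)))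
    linarith
  refine ⟨⟨E, hE, hPE, hfirst⟩, ?_⟩
  intro ε hε₀ hε₁ hiε c hc ξ hξ
  refine ⟨E, hE, hPE, fun ω hω => ?_⟩
  have hc0 : 0 ≤ c := by
    have := mul_nonneg LA.2 hD.le
    change 0 ≤ (LA : ℝ) * _ at this
    rwa [hc, div_mul_cancel₀ _ hD.ne'] at this
  have hmis : 0 ≤ OffPolicy.policyMismatch M ρ₀ π w i (fun e => X e ω) :=
    OffPolicy.replayMean_nonneg M.discount_pos.le M.discount_lt_one.le (fun e => (hw e).le) i _
      fun _ _ => OffPolicy.wasserstein1_nonneg _ _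
  have hbell : 0 ≤ OffPolicy.bellmanError M π w i (fun e => X e ω) Qhat :=
    OffPolicy.replayMean_nonneg M.discount_pos.le M.discount_lt_one.le (fun e => (hw e).le) i _
      fun _ _ => abs_nonneg _
  have hξ0 : 0 ≤ ξ ω := by
    have := mul_nonneg hbell hD.le
    rwa [hξ, div_mul_cancel₀ _ hD.ne'] at this
  have hlog : 1 / 4 ≤ Real.log (2 / δ) := by
    have h1 : Real.log 2 ≤ Real.log (2 / δ) :=
      Real.log_le_log (by norm_num) (by rw [le_div_iff₀ hδ₀]; linarith)
    linarith [Real.log_two_gt_d9]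
  -- The condition on i says (L - i) log γ ≤ log ε; the inequality turns around because log γ < 0.
  have htail : M.discount ^ (L - i) ≤ ε := by
    have hlγ : Real.log M.discount < 0 := Real.log_neg M.discount_pos M.discount_lt_one
    have h1 : Real.log ε / Real.log M.discount ≤ ((L - i : ℕ) : ℝ) := by
      rw [Nat.cast_sub hi]; linarith
    rw [div_le_iff_of_neg hlγ, ← Real.log_pow] at h1
    exact (Real.log_le_log_iff (pow_pos M.discount_pos _) hε₀).1 h1
  have hs1 : √((∑ e, w e ^ 2) / (2 * (∑ e, w e) ^ 2) * Real.log (2 / δ)) =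
      √(∑ e, w e ^ 2) / (∑ e, w e) * √(Real.log (2 / δ) / 2) := by
    rw [← Real.sqrt_sq hW.le, ← Real.sqrt_div' _ (sq_nonneg _), ← Real.sqrt_mul (by positivity),
      Real.sqrt_sq hW.le]
    congr 1
    field_simp
  have hs2 : √(2 * (∑ e, w e ^ 2) / (∑ e, w e) ^ 2 * Real.log (2 / δ)) =
      √(∑ e, w e ^ 2) / (∑ e, w e) * √(2 * Real.log (2 / δ)) := by
    rw [← Real.sqrt_sq hW.le, ← Real.sqrt_div' _ (sq_nonneg _), ← Real.sqrt_mul (by positivity),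
      Real.sqrt_sq hW.le]
    congr 1
    field_simp
  have hfin := hfirst ω hω
  rw [hs1, hs2] at hfin
  exact OffPolicy.normalized_bound hD hD1 hrmax Metric.diam_nonneg hc0 hc (by positivity) hlog htail
    hε₀.le hξ0 (hξ ω) hmis hfin
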